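/- Conventions. $\Sigma$ is a finite alphabet. An operator precedence matrix (OPM) $M$ on $\Sigma$ is conflict-free: it assigns at most one of the relations $\lessdot,\doteq,\gtrdot$ to each pair of terminals. It is extended to a delimiter $\#\notin\Sigma$ by $\#\lessdot a$ and $a\gtrdot\#$ for $a\in\Sigma$, and $\#\doteq\#$. An operator precedence grammar (OPG) $G$ is a context-free grammar (finitely many nonterminals and rules, axiom $S$) in which no right-hand side (rhs) has two adjacent nonterminals and at most one of the following relations holds for each pair $a,b\in\Sigma$ (here $B$ is a nonterminal or $\varepsilon$, and $D$ is a nonterminal): $a\doteq b$ if some rhs has the form $\alpha aBb\beta$; $a\lessdot b$ if some rhs has the form $\alpha aD\beta$ and $D\Rightarrow^* Bb\gamma$ for some $B$, $\gamma$; $a\gtrdot b$ if some rhs has the form $\alpha Db\beta$ and $D\Rightarrow^*\gamma aB$ for some $\gamma$, $B$. These relations form $\mathrm{OPM}(G)$. $G$ is in Fischer normal form (FNF) if no two rules have the same rhs and every empty rule $A\to\varepsilon$ and every renaming rule $A\to B$ has $A=S$. An operator precedence automaton (OPA) over $(\Sigma,M)$ has a finite state set $Q$, sets $I,F\subseteq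 Q$ of initial and final states, and relations $\delta_{\rm push},\delta_{\rm shift}\subseteq Q\times\Sigma\times Q$ and $\delta_{\rm pop}\subseteq Q\times Q\times Q$. Its stack holds pairs $[a\,p]\in\Sigma\times Q$ on a bottom symbol, which counts as $\#$. Let $c$ be the symbol on top of the stack, $b$ the next input symbol and $q$ the current state. If $c\lessdot b$ it may read $b$, push $[b\,q]$ and enter $r$ with $(q,b,r)\in\delta_{\rm push}$. If the top is $[c\,p]$ and $c\doteq b$, it may read $b$, replace the top by $[b\,p]$ and enter $r$ with $(q,b,r)\in\delta_{\rm shift}$. If the top is $[c\,p]$ and $c\gtrdot b$, it may pop it without reading and enter $r$ with $(q,p,r)\in\delta_{\rm pop}$. It accepts $x$ if, on input $x\#$, it can go from an initial state with empty stack to a final state with empty stack and only $\#$ left to read. It is deterministic if $|I|=1$ and the three relations are total functions. Theorem. 1. For every OPG $G$ and every OPM $M\supseteq\mathrm{OPM}(G)$ (in particular $M=\mathrm{OPM}(G)$) there is an OPA over $(\Sigma,M)$ that accepts $L(G)$. 2. If the relation $\doteq$ of $M$ has no circularities (there is no $a_1\doteq a_2\doteq\cdots\doteq a_n\doteq a_1$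 with $n\ge1$, $a_i\in\Sigma$), then the languages accepted by the OPAs over $(\Sigma,M)$ are exactly the languages generated by the OPGs $G$ with $\mathrm{OPM}(G)\subseteq M$. 3. There is an absolute constant $C$ such that for every OPA with $s$ states over any $(\Sigma,M)$ there is a deterministic OPA over the same $(\Sigma,M)$ with at most $2^{Cs^2}$ states that accepts the same language. 4. Let $G$ be an OPG in which all empty and renaming rules have lhs $S$, and in which $S$ occurs in no rhs if it has an empty or a renaming rule. Let $M\supseteq\mathrm{OPM}(G)$. Let $\mathbb P$ be the set of nonempty prefixes of rhs's that end with a terminal, and $V_N$ the set of nonterminals. Let $\mathcal A_G$ be the OPA over $(\Sigma,M)$ whose states are the pairs $\langle\alpha,\beta\rangle$ with $\alpha\in\{\varepsilon\}\cup\mathbb P\cup V_N$ and $\beta\in\{\varepsilon\}\cup\mathbb P$, with initial state $\langle\varepsilon,\varepsilon\rangle$, with final states $\langle S,\varepsilon\rangle$, $\langle A,\varepsilon\rangle$ for every rule $S\to A$, and $\langle\varepsilon,\varepsilon\rangle$ if $S\to\varepsilon$ is a rule, and with the following transitions, whenever the target is a state. - Push of $a$ from $\langle\alpha,\beta\rangle$: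 to $\langle a,\varepsilon\rangle$ if $\alpha\notin V_N$, to $\langle\alpha a,\beta\rangle$ if $\alpha\in V_N$. - Shift of $a$ from $\langle\alpha,\beta\rangle$: to $\langle\alpha a,\beta\rangle$ if $\alpha\notin V_N$, to $\langle\beta\alpha a,\varepsilon\rangle$ if $\alpha\in V_N$. - Pop from $\langle\alpha,\beta\rangle$ with popped state $\langle\gamma_1,\gamma_2\rangle$: to $\langle A,\gamma\rangle$ for every rule $A\to\alpha$ if $\alpha\notin V_N$, and for every rule $A\to\beta\alpha$ if $\alpha\in V_N$; here $\gamma=\gamma_1$ if $\gamma_1\notin V_N$ and $\gamma=\gamma_2$ otherwise. Then $\mathcal A_G$ has finitely many states and accepts $L(G)$. If moreover $G$ is in FNF, then $\mathcal A_G$ is already deterministic, up to sending all missing transitions to one additional nonfinal sink state, which does not change the language. 5. For every OPG $G$ in FNF and every OPM $M\supseteq\mathrm{OPM}(G)$ there is a deterministic OPA over $(\Sigma,M)$ that accepts $L(G)$. -/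

import Mathlib

/-- The three operator precedence relations. -/
inductive Prec where
  /-- `a` yields precedence to `b`, written `a ⋖ b`. -/
  | yields
  /-- `a` is equal in precedence to `b`, written `a ≐ b`. -/
  | equal
  /-- `a` takes precedence over `b`, written `a ⋗ b`. -/
  | takes

/-- A conflict-free operator precedence matrix on the terminal alphabet `T`: at most one relation
for each ordered pair of terminals.  The rows and columns of the delimiter `#` are fixed once and
for all by `OPM.rel` below. -/
def OPM (T : Type*) : Type _ := T → T → Option Prec

namespace OPM

variable {T : Type*}

/-- The matrix on `Σ ∪ {#}`, where `none` stands for the delimiter `#`: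
`# ⋖ a` and `a ⋗ #` for every terminal `a`, and `# ≐ #`. -/
def rel (M : OPM T) : Option T → Option T → Option Prec
  | some a, some b => M a b
  | none, some _ => some Prec.yields
  | some _, none => some Prec.takes
  | none, none => some Prec.equal

/-- The relation `≐` of the matrix has no circularities on `Σ`: there is no sequence
`a₁ ≐ a₂ ≐ ⋯ ≐ aₙ ≐ a₁` with `n ≥ 1`. -/
def EqualAcyclic (M : OPM T) : Prop :=
  ∀ a : T, ¬ Relation.TransGen (fun b c => M b c = some Prec.equal) a a

end OPM

/-! ### Operator precedence grammars -/

namespace ContextFreeGrammar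

variable {T : Type*}

/-- Operator form: no right-hand side has two adjacent nonterminals. -/
def IsOperatorGrammar (G : ContextFreeGrammar T) : Prop :=
  ∀ r ∈ G.rules, ∀ (α β : List (Symbol T G.NT)) (B C : G.NT),
    r.output ≠ α ++ Symbol.nonterminal B :: Symbol.nonterminal C :: β

/-- The string consisting of one nonterminal, or the empty string. -/
def optNT (G : ContextFreeGrammar T) : Option G.NT → List (Symbol T G.NT)
  | none => []
  | some B => [Symbol.nonterminal B]

/-- The left terminal set `{a | A ⇒* B a α, B a nonterminal or ε}`. -/
def leftTerminals (G : ContextFreeGrammar T) (A : G.NT) : Set T :=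
  {a | ∃ (B : Option G.NT) (α : List (Symbol T G.NT)),
    G.Derives [Symbol.nonterminal A] (G.optNT B ++ Symbol.terminal a :: α)}

/-- The right terminal set `{a | A ⇒* α a B, B a nonterminal or ε}`. -/
def rightTerminals (G : ContextFreeGrammar T) (A : G.NT) : Set T :=
  {a | ∃ (B : Option G.NT) (α : List (Symbol T G.NT)),
    G.Derives [Symbol.nonterminal A] (α ++ Symbol.terminal a :: G.optNT B)}

/-- `G.HasPrec r a b`: the precedence relation `r` holds between the terminals `a` and `b`, that
is, `r` belongs to the entry `(a, b)` of the operator precedence matrix of `G`. -/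
def HasPrec (G : ContextFreeGrammar T) : Prec → T → T → Prop
  | Prec.equal, a, b => ∃ r ∈ G.rules, ∃ (α β : List (Symbol T G.NT)) (B : Option G.NT),
      r.output = α ++ Symbol.terminal a :: (G.optNT B ++ Symbol.terminal b :: β)
  | Prec.takes, a, b => ∃ r ∈ G.rules, ∃ (α β : List (Symbol T G.NT)) (D : G.NT),
      r.output = α ++ Symbol.nonterminal D :: Symbol.terminal b :: β ∧ a ∈ G.rightTerminals D
  | Prec.yields, a, b => ∃ r ∈ G.rules, ∃ (α β : List (Symbol T G.NT)) (D : G.NT),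
      r.output = α ++ Symbol.terminal a :: Symbol.nonterminal D :: β ∧ b ∈ G.leftTerminals D

/-- An operator precedence grammar: finitely many nonterminals, rules in operator form, and a
conflict-free precedence matrix. -/
structure IsOPG (G : ContextFreeGrammar T) : Prop where
  finite_nonterminals : Finite G.NT
  operator_form : G.IsOperatorGrammar
  conflict_free : ∀ (a b : T) (r r' : Prec), G.HasPrec r a b → G.HasPrec r' a b → r = r'

/-- `M` is the operator precedence matrix of `G`. -/
def HasOPM (G : ContextFreeGrammar T) (M : OPM T) : Prop :=
  ∀ (a b : T) (r : Prec), M a b = some r ↔ G.HasPrec r a b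

/-- The operator precedence matrix of `G` is contained in `M`. -/
def OPMSubset (G : ContextFreeGrammar T) (M : OPM T) : Prop :=
  ∀ (a b : T) (r : Prec), G.HasPrec r a b → M a b = some r

/-- No two rules have the same right-hand side. -/
def IsInvertible (G : ContextFreeGrammar T) : Prop :=
  ∀ r ∈ G.rules, ∀ r' ∈ G.rules, r.output = r'.output → r = r'

/-- An empty rule `A → ε`, or a renaming rule `A → B`. -/
def IsEmptyOrRenaming (G : ContextFreeGrammar T) (r : ContextFreeRule T G.NT) : Prop :=
  r.output = [] ∨ ∃ B : G.NT, r.output = [Symbol.nonterminal B]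

/-- There are no empty rules except possibly `S → ε`, and no renaming rules except possibly those
whose left-hand side is the axiom `S`. -/
def OnlyAxiomEmptyOrRenaming (G : ContextFreeGrammar T) : Prop :=
  ∀ r ∈ G.rules, G.IsEmptyOrRenaming r → r.input = G.initial

/-- Fischer normal form. -/
structure IsFNF (G : ContextFreeGrammar T) : Prop where
  invertible : G.IsInvertible
  only_axiom : G.OnlyAxiomEmptyOrRenaming

/-- If the axiom `S` has an empty or a renaming rule, then it occurs in no right-hand side. -/
def AxiomIsolated (G : ContextFreeGrammar T) : Prop :=
  (∃ r ∈ G.rules, r.input = G.initial ∧ G.IsEmptyOrRenaming r) →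
    ∀ r ∈ G.rules, Symbol.nonterminal G.initial ∉ r.output

end ContextFreeGrammar

/-! ### Operator precedence automata -/

/-- An operator precedence automaton over the operator precedence alphabet `(T, M)` with set of
states `Q` (finiteness of `T` and `Q` is required where automata are used). -/
structure OPA {T : Type*} (M : OPM T) (Q : Type*) where
  initial : Set Q
  final : Set Q
  push : Q → T → Q → Prop
  shift : Q → T → Q → Prop
  pop : Q → Q → Q → Prop

/-- A configuration: the remaining input (followed by an implicit `#`), the current state, and the
stack with its top first (resting on an implicit bottom symbol `Z₀`). -/
structure OPAConfig (T Q : Type*) where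
  input : List T
  state : Q
  stack : List (T × Q)

namespace OPA

variable {T Q : Type*} {M : OPM T}

/-- The terminal on top of the stack; `none`, that is `#`, if the stack contains only `Z₀`. -/
def topSymbol (s : List (T × Q)) : Option T := s.head?.map Prod.fst

/-- The moves of the automaton.  In a pop move `x.head?` is the next input symbol, `none`
standing for `#`. -/
inductive Move (A : OPA M Q) : OPAConfig T Q → OPAConfig T Q → Prop
  | push (a : T) (x : List T) (p q : Q) (s : List (T × Q))
      (h : M.rel (topSymbol s) (some a) = some Prec.yields) (hδ : A.push p a q) :
      Move A ⟨a :: x, p, s⟩ ⟨x, q, (a, p) :: s⟩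
  | shift (a b : T) (x : List T) (p q r : Q) (s : List (T × Q))
      (h : M.rel (some a) (some b) = some Prec.equal) (hδ : A.shift q b r) :
      Move A ⟨b :: x, q, (a, p) :: s⟩ ⟨x, r, (b, p) :: s⟩
  | pop (a : T) (x : List T) (p q r : Q) (s : List (T × Q))
      (h : M.rel (some a) x.head? = some Prec.takes) (hδ : A.pop q p r) :
      Move A ⟨x, q, (a, p) :: s⟩ ⟨x, r, s⟩

/-- The language accepted by the automaton. -/
def language (A : OPA M Q) : Language T :=
  {x | ∃ i ∈ A.initial, ∃ f ∈ A.final,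
    Relation.ReflTransGen A.Move ⟨x, i, []⟩ ⟨[], f, []⟩}

/-- One initial state, and the three components of the transition relation are (total)
functions. -/
structure IsDeterministic (A : OPA M Q) : Prop where
  initial_singleton : ∃ i, A.initial = {i}
  push_function : ∀ (q : Q) (a : T), ∃! r, A.push q a r
  shift_function : ∀ (q : Q) (a : T), ∃! r, A.shift q a r
  pop_function : ∀ q p : Q, ∃! r, A.pop q p r

/-- The automaton with one more, nonfinal, state `none`, to which every missing transition
leads. -/
def completion (A : OPA M Q) : OPA M (Option Q) where
  initial := some '' A.initial
  final := some '' A.final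
  push q a r :=
    (∃ q₀ r₀, q = some q₀ ∧ r = some r₀ ∧ A.push q₀ a r₀) ∨
      (r = none ∧ ∀ q₀ r₀, q = some q₀ → ¬ A.push q₀ a r₀)
  shift q a r :=
    (∃ q₀ r₀, q = some q₀ ∧ r = some r₀ ∧ A.shift q₀ a r₀) ∨
      (r = none ∧ ∀ q₀ r₀, q = some q₀ → ¬ A.shift q₀ a r₀)
  pop q p r :=
    (∃ q₀ p₀ r₀, q = some q₀ ∧ p = some p₀ ∧ r = some r₀ ∧ A.pop q₀ p₀ r₀) ∨
      (r = none ∧ ∀ q₀ p₀ r₀, q = some q₀ → p = some p₀ → ¬ A.pop q₀ p₀ r₀)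

end OPA

/-! ### The automaton built from a grammar -/

namespace ContextFreeGrammar

variable {T : Type*}

/-- The nonempty prefixes of right-hand sides that end with a terminal. -/
def rhsPrefixes (G : ContextFreeGrammar T) : Set (List (Symbol T G.NT)) :=
  {α | (∃ r ∈ G.rules, α <+: r.output) ∧ ∃ γ a, α = γ ++ [Symbol.terminal a]}

/-- The states of the automaton built from `G`.  The first component is the prefix of the
right-hand side under construction, or the nonterminal to which a right-hand side has just been
reduced; in the latter case the second component is the prefix of the right-hand side that was
under construction before, and is resumed now. -/
@[ext]
structure PrefixState (G : ContextFreeGrammar T) where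
  current : List (Symbol T G.NT)
  suspended : List (Symbol T G.NT)
  current_mem : current = [] ∨ current ∈ G.rhsPrefixes ∨ ∃ B, current = [Symbol.nonterminal B]
  suspended_mem : suspended = [] ∨ suspended ∈ G.rhsPrefixes

/-- The first component of the state is a nonterminal. -/
def PrefixState.IsReduced {G : ContextFreeGrammar T} (q : G.PrefixState) : Prop :=
  ∃ B, q.current = [Symbol.nonterminal B]

/-- The automaton built from `G`, over the matrix `M`.  It pushes when it reads the first terminal
of a right-hand side, shifts when it reads a further terminal of it, and pops when the right-hand
side is complete, choosing a left-hand side for it. -/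
def prefixAutomaton (G : ContextFreeGrammar T) (M : OPM T) : OPA M G.PrefixState where
  initial := {q | q.current = [] ∧ q.suspended = []}
  final := {q | q.suspended = [] ∧
    ((q.current = [] ∧ ⟨G.initial, []⟩ ∈ G.rules) ∨
      ∃ A, q.current = [Symbol.nonterminal A] ∧
        (A = G.initial ∨ ⟨G.initial, [Symbol.nonterminal A]⟩ ∈ G.rules))}
  push p a q :=
    (¬ p.IsReduced ∧ q.current = [Symbol.terminal a] ∧ q.suspended = []) ∨
      (p.IsReduced ∧ q.current = p.current ++ [Symbol.terminal a] ∧ q.suspended = p.suspended)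
  shift p a q :=
    (¬ p.IsReduced ∧ q.current = p.current ++ [Symbol.terminal a] ∧ q.suspended = p.suspended) ∨
      (p.IsReduced ∧ q.current = p.suspended ++ p.current ++ [Symbol.terminal a] ∧
        q.suspended = [])
  pop p s q := ∃ A, q.current = [Symbol.nonterminal A] ∧
    ((¬ p.IsReduced ∧ ⟨A, p.current⟩ ∈ G.rules) ∨
      (p.IsReduced ∧ ⟨A, p.suspended ++ p.current⟩ ∈ G.rules)) ∧
    ((¬ s.IsReduced ∧ q.suspended = s.current) ∨
      (s.IsReduced ∧ q.suspended = s.suspended))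

end ContextFreeGrammar

/-! The matrix alone decides whether a push, a shift or a pop is possible, so runs on the same word
go through stacks with the same terminals and differ only in their states. A push opens a right-hand
side, shifts extend it along `≐`, and a pop closes it.

From grammars to automata: the states of `prefixAutomaton` record the right-hand sides under
construction. Soundness is the invariant `Reads`: the word read so far is derived from the prefixes
held by stack and state. Completeness is an induction on derivations for `ReducesTo`: a word of `A`
is reduced to `A` in every context whose neighbouring terminals stand in the relations `⋖` and `⋗`
to the left and right terminals of `A`, and `OPMSubset` provides such contexts inside every
right-hand side. Operator form puts at most one nonterminal between two terminals, so one suspended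
prefix is enough. A right-hand side without terminals is never pushed; hence empty and renaming
rules are allowed at the axiom only, where the final states absorb them. An arbitrary grammar is
first replaced by `proper`, whose rules below the axiom are `A → w` with `A ⇒* w` and `w` an erasure
of a right-hand side. Erasing nonterminals from a string in operator form creates no new precedence
relation, so the same matrix still works.

From automata to grammars: a nonterminal `(a, q, q', b)` stands for the words that lead from `q` to
`q'` between the terminals `a` and `b` and leave the stack as it was. Carrying `a` and `b` along
forces all precedence relations of the grammar into `M`. The terminals of a right-hand side form a
chain of `≐`; without circularities the chain has no repetition, and there are finitely many rules.

Determinization: a subset construction on pairs of the current state and the state stored on top of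
the stack. A pop composes the pairs of the current set with those of the stored set, so there are `2
^ s²` sets. -/

/-! ### Words derived from sentential forms -/

/-- `Yield R v x`: the word `x` is obtained from `v` by replacing each nonterminal `N` by a word
`y` with `R N y`. -/
inductive Yield {T N : Type*} (R : N → List T → Prop) : List (Symbol T N) → List T → Prop
  | nil : Yield R [] []
  | terminal (a : T) {v : List (Symbol T N)} {x : List T} :
      Yield R v x → Yield R (Symbol.terminal a :: v) (a :: x)
  | nonterminal (B : N) {v : List (Symbol T N)} {x y : List T} :
      R B y → Yield R v x → Yield R (Symbol.nonterminal B :: v) (y ++ x)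

namespace Yield

variable {T N : Type*} {R R' : N → List T → Prop} {u v : List (Symbol T N)} {x y : List T}

theorem mono (hR : ∀ B y, Symbol.nonterminal B ∈ v → R B y → R' B y) (h : Yield R v x) :
    Yield R' v x := by
  induction h with
  | nil => exact nil
  | terminal a _ ih => exact terminal a (ih fun B y hB => hR B y (List.mem_cons_of_mem _ hB))
  | nonterminal B hB _ ih =>
    exact nonterminal B (hR B _ List.mem_cons_self hB)
      (ih fun B y hB => hR B y (List.mem_cons_of_mem _ hB))

theorem append (hu : Yield R u x) (hv : Yield R v y) : Yield R (u ++ v) (x ++ y) := by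
  induction hu with
  | nil => exact hv
  | terminal a _ ih => exact terminal a ih
  | nonterminal B hB _ ih => rw [List.append_assoc]; exact nonterminal B hB ih

theorem exists_of_append (h : Yield R (u ++ v) x) :
    ∃ x₁ x₂, x = x₁ ++ x₂ ∧ Yield R u x₁ ∧ Yield R v x₂ := by
  induction u generalizing x with
  | nil => exact ⟨[], x, rfl, nil, h⟩
  | cons s u ih =>
    cases h with
    | terminal a h =>
      obtain ⟨x₁, x₂, rfl, h₁, h₂⟩ := ih h
      exact ⟨a :: x₁, x₂, rfl, terminal a h₁, h₂⟩
    | nonterminal B hB h =>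
      obtain ⟨x₁, x₂, rfl, h₁, h₂⟩ := ih h
      exact ⟨_ ++ x₁, x₂, (List.append_assoc _ _ _).symm, nonterminal B hB h₁, h₂⟩

theorem singleton {B : N} (h : R B x) : Yield R [Symbol.nonterminal B] x := by
  simpa using nonterminal B h nil

theorem of_singleton {B : N} (h : Yield R [Symbol.nonterminal B] x) : R B x := by
  cases h with
  | nonterminal B hB h => cases h; simpa using hB

theorem of_singleton_terminal {a : T} (h : Yield R [Symbol.terminal a] x) : x = [a] := by
  cases h with
  | terminal a h => cases h; rfl

theorem singleton_terminal (a : T) : Yield R [Symbol.terminal a] [a] := terminal a nil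

theorem eq_nil (h : Yield R [] x) : x = [] := by
  cases h; rfl

theorem map_terminal (x : List T) : Yield R (x.map Symbol.terminal) x := by
  induction x with
  | nil => exact nil
  | cons a x ih => exact terminal a ih

end Yield

namespace ContextFreeGrammar

variable {T : Type*} {G : ContextFreeGrammar T}

theorem Derives.append {u u' v v' : List (Symbol T G.NT)} (hu : G.Derives u u')
    (hv : G.Derives v v') : G.Derives (u ++ v) (u' ++ v') :=
  (hu.append_right v).trans (hv.append_left u')

theorem derives_rule {A : G.NT} {v : List (Symbol T G.NT)} (h : ⟨A, v⟩ ∈ G.rules) :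
    G.Derives [Symbol.nonterminal A] v :=
  Produces.single ⟨_, h, ContextFreeRule.Rewrites.input_output⟩

/-- The words derived from a nonterminal. -/
def Gen (G : ContextFreeGrammar T) (A : G.NT) (x : List T) : Prop :=
  G.Derives [Symbol.nonterminal A] (x.map Symbol.terminal)

/-- Induction on derivations of words: a relation closed under the rules contains `G.Gen`. -/
theorem yield_of_derives {R : G.NT → List T → Prop}
    (hR : ∀ A v x, ⟨A, v⟩ ∈ G.rules → Yield R v x → R A x) {v : List (Symbol T G.NT)}
    {x : List T} (h : G.Derives v (x.map Symbol.terminal)) : Yield R v x := by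
  induction h using Relation.ReflTransGen.head_induction_on with
  | refl => exact Yield.map_terminal x
  | head h _ ih =>
    obtain ⟨r, hr, h⟩ := h
    obtain ⟨p, q, rfl, rfl⟩ := h.exists_parts
    -- The factor of the word that comes from the inserted right-hand side belongs to the rewritten
    -- nonterminal by `hR`.
    obtain ⟨y, z, rfl, hy, hz⟩ := ih.exists_of_append
    obtain ⟨y₁, y₂, rfl, hy₁, hy₂⟩ := hy.exists_of_append
    exact (hy₁.append (Yield.singleton (hR _ _ _ hr hy₂))).append hz

theorem derives_of_yield {v : List (Symbol T G.NT)} {x : List T} (h : Yield G.Gen v x) :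
    G.Derives v (x.map Symbol.terminal) := by
  induction h with
  | nil => exact Derives.refl _
  | terminal a _ ih => exact ih.append_left [Symbol.terminal a]
  | nonterminal B hB _ ih => simpa using Derives.append hB ih

theorem gen_of_rule {A : G.NT} {v : List (Symbol T G.NT)} {x : List T} (h : ⟨A, v⟩ ∈ G.rules)
    (hx : Yield G.Gen v x) : G.Gen A x :=
  (derives_rule h).trans (derives_of_yield hx)

theorem yield_gen_of_derives {v : List (Symbol T G.NT)} {x : List T}
    (h : G.Derives v (x.map Symbol.terminal)) : Yield G.Gen v x :=
  yield_of_derives (fun _ _ _ hr hx => gen_of_rule hr hx) h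

/-- Induction on derivations of words, keeping the information that the words are derived. -/
theorem Gen.induction {R : G.NT → List T → Prop}
    (hR : ∀ A v x, ⟨A, v⟩ ∈ G.rules → Yield (fun B y => G.Gen B y ∧ R B y) v x → R A x)
    {A : G.NT} {x : List T} (h : G.Gen A x) : R A x :=
  (yield_of_derives (R := fun B y => G.Gen B y ∧ R B y)
    (fun A v x hr hx => ⟨gen_of_rule hr (hx.mono fun _ _ _ h => h.1), hR A v x hr hx⟩)
    h).of_singleton.2

/-- The first rule of a derivation from a nonterminal. -/
theorem exists_rule_of_derives {A : G.NT} {w : List (Symbol T G.NT)}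
    (h : G.Derives [Symbol.nonterminal A] w) (hw : w ≠ [Symbol.nonterminal A]) :
    ∃ v, ⟨A, v⟩ ∈ G.rules ∧ G.Derives v w := by
  obtain rfl | ⟨v, ⟨r, hr, h₁⟩, h₂⟩ := h.eq_or_head
  · exact absurd rfl hw
  · obtain ⟨p, q, hp, rfl⟩ := h₁.exists_parts
    rcases p with _ | ⟨s, p⟩
    · simp only [List.nil_append, List.singleton_append, List.cons.injEq,
        Symbol.nonterminal.injEq] at hp
      obtain ⟨rfl, rfl⟩ := hp
      exact ⟨r.output, hr, by simpa using h₂⟩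
    · simp at hp

theorem Gen.exists_rule {A : G.NT} {x : List T} (h : G.Gen A x) :
    ∃ v, ⟨A, v⟩ ∈ G.rules ∧ G.Derives v (x.map Symbol.terminal) := by
  refine exists_rule_of_derives h fun h' => ?_
  rcases x with _ | ⟨a, x⟩ <;> simp at h'

end ContextFreeGrammar

/-! ### Runs and renaming of states -/

namespace OPA

variable {T Q Q' : Type*} {M : OPM T}

/-- A map between state sets under which the moves of `A` become moves of `B`. -/
theorem Move.map {A : OPA M Q} {B : OPA M Q'} (f : Q → Q')
    (hpush : ∀ p a q, A.push p a q → B.push (f p) a (f q))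
    (hshift : ∀ p a q, A.shift p a q → B.shift (f p) a (f q))
    (hpop : ∀ p s q, A.pop p s q → B.pop (f p) (f s) (f q)) {c d : OPAConfig T Q}
    (h : A.Move c d) :
    B.Move ⟨c.input, f c.state, c.stack.map (Prod.map id f)⟩
      ⟨d.input, f d.state, d.stack.map (Prod.map id f)⟩ := by
  have htop : ∀ s : List (T × Q), topSymbol (s.map (Prod.map id f)) = topSymbol s := by
    rintro (_ | ⟨⟨a, p⟩, s⟩) <;> rfl
  cases h with
  | push a x p q s h hδ => exact Move.push a x _ _ _ ((htop s).symm ▸ h) (hpush _ _ _ hδ)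
  | shift a b x p q r s h hδ => exact Move.shift a b x _ _ _ _ h (hshift _ _ _ hδ)
  | pop a x p q r s h hδ => exact Move.pop a x _ _ _ _ h (hpop _ _ _ hδ)

theorem run_map {A : OPA M Q} {B : OPA M Q'} (f : Q → Q')
    (hpush : ∀ p a q, A.push p a q → B.push (f p) a (f q))
    (hshift : ∀ p a q, A.shift p a q → B.shift (f p) a (f q))
    (hpop : ∀ p s q, A.pop p s q → B.pop (f p) (f s) (f q)) {c d : OPAConfig T Q}
    (h : Relation.ReflTransGen A.Move c d) :
    Relation.ReflTransGen B.Move ⟨c.input, f c.state, c.stack.map (Prod.map id f)⟩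
      ⟨d.input, f d.state, d.stack.map (Prod.map id f)⟩ := by
  induction h with
  | refl => exact Relation.ReflTransGen.refl
  | tail _ h ih => exact ih.tail (h.map f hpush hshift hpop)

theorem language_le_of_map {A : OPA M Q} {B : OPA M Q'} (f : Q → Q')
    (hinitial : ∀ q ∈ A.initial, f q ∈ B.initial) (hfinal : ∀ q ∈ A.final, f q ∈ B.final)
    (hpush : ∀ p a q, A.push p a q → B.push (f p) a (f q))
    (hshift : ∀ p a q, A.shift p a q → B.shift (f p) a (f q))
    (hpop : ∀ p s q, A.pop p s q → B.pop (f p) (f s) (f q)) :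
    ∀ x ∈ A.language, x ∈ B.language := by
  rintro x ⟨i, hi, q, hq, h⟩
  exact ⟨f i, hinitial i hi, f q, hfinal q hq, run_map f hpush hshift hpop h⟩

/-- The automaton with its states renamed along an equivalence. -/
def relabel (A : OPA M Q) (e : Q ≃ Q') : OPA M Q' where
  initial := {q | e.symm q ∈ A.initial}
  final := {q | e.symm q ∈ A.final}
  push p a q := A.push (e.symm p) a (e.symm q)
  shift p a q := A.shift (e.symm p) a (e.symm q)
  pop p s q := A.pop (e.symm p) (e.symm s) (e.symm q)

theorem language_relabel (A : OPA M Q) (e : Q ≃ Q') : (A.relabel e).language = A.language := by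
  ext x
  constructor
  · exact language_le_of_map e.symm (fun _ h => h) (fun _ h => h) (fun _ _ _ h => h)
      (fun _ _ _ h => h) (fun _ _ _ h => h) x
  · exact language_le_of_map e (by simp [relabel]) (by simp [relabel]) (by simp [relabel])
      (by simp [relabel]) (by simp [relabel]) x

theorem existsUnique_symm (e : Q ≃ Q') {P : Q → Prop} (h : ∃! q, P q) : ∃! q, P (e.symm q) := by
  obtain ⟨q, hq, hu⟩ := h
  exact ⟨e q, by simpa using hq, fun q' hq' => by rw [← hu _ hq', Equiv.apply_symm_apply]⟩

theorem IsDeterministic.relabel {A : OPA M Q} (h : A.IsDeterministic) (e : Q ≃ Q') :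
    (A.relabel e).IsDeterministic where
  initial_singleton := by
    obtain ⟨i, hi⟩ := h.initial_singleton
    refine ⟨e i, ?_⟩
    ext q
    simp [OPA.relabel, hi, Equiv.symm_apply_eq]
  push_function q a := existsUnique_symm e (h.push_function _ _)
  shift_function q a := existsUnique_symm e (h.shift_function _ _)
  pop_function q p := existsUnique_symm e (h.pop_function _ _)

/-- Every finite state set may be replaced by one in the lowest universe. -/
theorem exists_relabel [Finite Q] (A : OPA M Q) :
    ∃ (Q' : Type) (_ : Finite Q') (A' : OPA M Q'), A'.language = A.language ∧
      (A.IsDeterministic → A'.IsDeterministic) ∧ Nat.card Q' = Nat.card Q :=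
  ⟨Fin (Nat.card Q), inferInstance, A.relabel (Finite.equivFin Q), A.language_relabel _,
    fun h => h.relabel _, by simp⟩

/-! ### Determinization -/

/-- The deterministic automaton whose states are sets of pairs of a state and of the state stored
in the topmost stack symbol. -/
def determinization (A : OPA M Q) : OPA M (Set (Q × Q)) where
  -- On the empty stack no state is stored, and the second component is a dummy.
  initial := {{z | z.1 = z.2 ∧ z.1 ∈ A.initial}}
  final := {K | ∃ z ∈ K, z.1 ∈ A.final}
  push K a L := L = {z | ∃ p, (z.2, p) ∈ K ∧ A.push z.2 a z.1}
  shift K a L := L = {z | ∃ q, (q, z.2) ∈ K ∧ A.shift q a z.1}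
  pop K K' L := L = {z | ∃ q p, (q, p) ∈ K ∧ (p, z.2) ∈ K' ∧ A.pop q p z.1}

theorem isDeterministic_determinization (A : OPA M Q) : A.determinization.IsDeterministic where
  initial_singleton := ⟨_, rfl⟩
  push_function _ _ := ⟨_, rfl, fun _ h => h⟩
  shift_function _ _ := ⟨_, rfl, fun _ h => h⟩
  pop_function _ _ := ⟨_, rfl, fun _ h => h⟩

/-- The stack contents and states of `A` that are represented by those of its determinization. -/
inductive Threads : Set (Q × Q) → List (T × Set (Q × Q)) → Q → List (T × Q) → Prop
  | nil {K : Set (Q × Q)} {q p : Q} (h : (q, p) ∈ K) : Threads K [] q []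
  | cons {K K' : Set (Q × Q)} {S : List (T × Set (Q × Q))} {q p : Q} {s : List (T × Q)} (a : T)
      (h : (q, p) ∈ K) (hs : Threads K' S p s) : Threads K ((a, K') :: S) q ((a, p) :: s)

theorem Threads.topSymbol_eq {K : Set (Q × Q)} {S : List (T × Set (Q × Q))} {q : Q}
    {s : List (T × Q)} (h : Threads K S q s) : topSymbol S = topSymbol s := by
  cases h <;> rfl

theorem Threads.exists_mem {K : Set (Q × Q)} {S : List (T × Set (Q × Q))} {q : Q}
    {s : List (T × Q)} (h : Threads K S q s) : ∃ p, (q, p) ∈ K := by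
  cases h with
  | nil h => exact ⟨_, h⟩
  | cons _ h => exact ⟨_, h⟩

/-- The state on top of a represented stack may be replaced. -/
theorem Threads.replace {K L : Set (Q × Q)} {S : List (T × Set (Q × Q))} {q r : Q}
    {s : List (T × Q)} (h : Threads K S q s) (hL : ∀ p, (q, p) ∈ K → (r, p) ∈ L) :
    Threads L S r s := by
  cases h with
  | nil h => exact .nil (hL _ h)
  | cons a h hs => exact .cons a (hL _ h) hs

theorem determinization_simulates (A : OPA M Q) {c d : OPAConfig T Q} (h : A.Move c d)
    {K : Set (Q × Q)} {S : List (T × Set (Q × Q))} (hc : Threads K S c.state c.stack) :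
    ∃ L S', A.determinization.Move ⟨c.input, K, S⟩ ⟨d.input, L, S'⟩ ∧
      Threads L S' d.state d.stack := by
  cases h with
  | push a x p q s h hδ =>
    obtain ⟨p', hp'⟩ := hc.exists_mem
    exact ⟨_, _, .push a x K _ S (hc.topSymbol_eq.symm ▸ h) rfl, .cons a ⟨p', hp', hδ⟩ hc⟩
  | shift a b x p q r s h hδ =>
    cases hc with
    | cons _ hK hs => exact ⟨_, _, .shift a b x _ K _ _ h rfl, .cons b ⟨q, hK, hδ⟩ hs⟩
  | pop a x p q r s h hδ =>
    cases hc with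
    | cons _ hK hs =>
      exact ⟨_, _, .pop a x _ K _ _ h rfl, hs.replace fun p' hp' => ⟨q, p, hK, hp', hδ⟩⟩

/-- Every pair in a set of the determinization has a witness in the preceding sets, so a thread can
be pulled back along each move. The direction matters: the thread has to end in a prescribed final
state, so it is built from the end of the run. -/
theorem determinization_reflects (A : OPA M Q) {C D : OPAConfig T (Set (Q × Q))}
    (h : A.determinization.Move C D) {q : Q} {s : List (T × Q)}
    (hD : Threads D.state D.stack q s) :
    ∃ p t, A.Move ⟨C.input, p, t⟩ ⟨D.input, q, s⟩ ∧ Threads C.state C.stack p t := by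
  cases h with
  | push a x K L S h hδ =>
    cases hδ
    cases hD with
    | cons _ hL hs =>
      obtain ⟨p', hp', hδ⟩ := hL
      exact ⟨_, _, .push a x _ _ _ (hs.topSymbol_eq ▸ h) hδ, hs⟩
  | shift a b x K' K L S h hδ =>
    cases hδ
    cases hD with
    | cons _ hL hs =>
      obtain ⟨q', hq', hδ⟩ := hL
      exact ⟨_, _, .shift a b x _ _ _ _ h hδ, .cons a hq' hs⟩
  | pop a x K' K L S h hδ =>
    cases hδ
    cases hD with
    | nil hL =>
      obtain ⟨q', p', hq', hp', hδ⟩ := hL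
      exact ⟨_, _, .pop a x _ _ _ _ h hδ, .cons a hq' (.nil hp')⟩
    | cons b hL hs =>
      obtain ⟨q', p', hq', hp', hδ⟩ := hL
      exact ⟨_, _, .pop a x _ _ _ _ h hδ, .cons a hq' (.cons b hp' hs)⟩

theorem language_determinization (A : OPA M Q) : A.determinization.language = A.language := by
  ext x
  constructor
  · rintro ⟨I, hI, K, ⟨⟨f, p⟩, hK, hf⟩, h⟩
    have key : ∀ C D : OPAConfig T (Set (Q × Q)), Relation.ReflTransGen A.determinization.Move C D →
        ∀ q s, Threads D.state D.stack q s → ∃ p t, Threads C.state C.stack p t ∧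
          Relation.ReflTransGen A.Move ⟨C.input, p, t⟩ ⟨D.input, q, s⟩ := by
      intro C D h
      induction h with
      | refl => exact fun q s hs => ⟨q, s, hs, .refl⟩
      | tail _ h ih =>
        intro q s hs
        obtain ⟨p, t, h₁, ht⟩ := A.determinization_reflects h hs
        obtain ⟨p', t', ht', h₂⟩ := ih p t ht
        exact ⟨p', t', ht', h₂.tail h₁⟩
    obtain ⟨i, t, ht, hrun⟩ := key _ _ h f [] (.nil hK)
    cases hI
    cases ht with
    | nil hi => exact ⟨i, hi.2, f, hf, hrun⟩
  · rintro ⟨i, hi, f, hf, h⟩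
    have key : ∀ c d : OPAConfig T Q, Relation.ReflTransGen A.Move c d →
        ∀ K S, Threads K S c.state c.stack → ∃ L S', Threads L S' d.state d.stack ∧
          Relation.ReflTransGen A.determinization.Move ⟨c.input, K, S⟩ ⟨d.input, L, S'⟩ := by
      intro c d h
      induction h with
      | refl => exact fun K S hS => ⟨K, S, hS, .refl⟩
      | tail _ h ih =>
        intro K S hS
        obtain ⟨L, S', hS', h₁⟩ := ih K S hS
        obtain ⟨L', S'', h₂, hS''⟩ := A.determinization_simulates h hS'
        exact ⟨L', S'', hS'', h₁.tail h₂⟩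
    obtain ⟨L, S, hS, hrun⟩ := key _ _ h {z | z.1 = z.2 ∧ z.1 ∈ A.initial} [] (.nil ⟨rfl, hi⟩)
    cases hS with
    | nil hL => exact ⟨_, rfl, L, ⟨_, hL, hf⟩, hrun⟩

/-- Determinization with `2 ^ s²` states. -/
theorem exists_isDeterministic [Finite Q] (A : OPA M Q) :
    ∃ (Q' : Type) (_ : Finite Q') (D : OPA M Q'), D.IsDeterministic ∧
      D.language = A.language ∧ Nat.card Q' = 2 ^ (Nat.card Q ^ 2) := by
  obtain ⟨Q', hQ', D, hD, hdet, hcard⟩ := A.determinization.exists_relabel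
  refine ⟨Q', hQ', D, hdet A.isDeterministic_determinization,
    hD.trans A.language_determinization, hcard.trans ?_⟩
  have := Fintype.ofFinite Q
  rw [Nat.card_eq_fintype_card, Fintype.card_set, Fintype.card_prod, Nat.card_eq_fintype_card, sq]

end OPA

namespace ContextFreeGrammar

variable {T : Type*} {G : ContextFreeGrammar T} {M : OPM T}

/-! ### Terminal sets of the nonterminals of a right-hand side -/

theorem leftTerminals_subset_of_rule {A B : G.NT} {v : List (Symbol T G.NT)}
    (h : ⟨A, Symbol.nonterminal B :: v⟩ ∈ G.rules) : G.leftTerminals B ⊆ G.leftTerminals A := by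
  rintro a ⟨C, α, hC⟩
  exact ⟨C, α ++ v, by simpa using (derives_rule h).trans (hC.append_right v)⟩

theorem rightTerminals_subset_of_rule {A B : G.NT} {v : List (Symbol T G.NT)}
    (h : ⟨A, v ++ [Symbol.nonterminal B]⟩ ∈ G.rules) :
    G.rightTerminals B ⊆ G.rightTerminals A := by
  rintro a ⟨C, α, hC⟩
  exact ⟨C, v ++ α, by simpa using (derives_rule h).trans (hC.append_left v)⟩

/-- A nonempty string in operator form that is not a single nonterminal contains a terminal, and
at most one nonterminal precedes the first one. -/
theorem exists_first_terminal {v : List (Symbol T G.NT)}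
    (hv : ∀ (α β : List (Symbol T G.NT)) (B C : G.NT),
      v ≠ α ++ Symbol.nonterminal B :: Symbol.nonterminal C :: β)
    (h₀ : v ≠ []) (h₁ : ∀ B, v ≠ [Symbol.nonterminal B]) :
    ∃ (B : Option G.NT) (a : T) (w : List (Symbol T G.NT)),
      v = G.optNT B ++ Symbol.terminal a :: w := by
  rcases v with _ | ⟨a | B, v⟩
  · exact absurd rfl h₀
  · exact ⟨none, a, v, rfl⟩
  · rcases v with _ | ⟨a | C, v⟩
    · exact absurd rfl (h₁ B)
    · exact ⟨some B, a, v, rfl⟩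
    · exact absurd rfl (hv [] v B C)

/-! ### States of the automaton built from a grammar -/

theorem finite_rhsPrefixes (G : ContextFreeGrammar T) : G.rhsPrefixes.Finite := by
  refine Set.Finite.subset (Set.Finite.biUnion G.rules.finite_toSet
    fun r _ => r.output.inits.finite_toSet) ?_
  rintro α ⟨⟨r, hr, hα⟩, -⟩
  simpa using ⟨r, hr, hα⟩

theorem finite_prefixState (G : ContextFreeGrammar T) [Finite G.NT] : Finite G.PrefixState := by
  have h₁ : ({[]} ∪ G.rhsPrefixes ∪ Set.range fun B : G.NT =>
      [(Symbol.nonterminal B : Symbol T G.NT)]).Finite :=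
    ((Set.finite_singleton _).union G.finite_rhsPrefixes).union (Set.finite_range _)
  have h₂ : ({[]} ∪ G.rhsPrefixes : Set (List (Symbol T G.NT))).Finite :=
    (Set.finite_singleton _).union G.finite_rhsPrefixes
  have := h₁.to_subtype
  have := h₂.to_subtype
  refine Finite.of_injective (fun q : G.PrefixState =>
    ((⟨q.current, ?_⟩, ⟨q.suspended, ?_⟩) : ↥({[]} ∪ G.rhsPrefixes ∪ Set.range fun B : G.NT =>
      [(Symbol.nonterminal B : Symbol T G.NT)]) × ↥({[]} ∪ G.rhsPrefixes))) ?_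
  · rcases q.current_mem with h | h | ⟨B, h⟩
    · exact Or.inl (Or.inl h)
    · exact Or.inl (Or.inr h)
    · exact Or.inr ⟨B, h.symm⟩
  · exact q.suspended_mem
  · intro p q h
    simp only [Prod.mk.injEq] at h
    exact PrefixState.ext (congrArg Subtype.val h.1) (congrArg Subtype.val h.2)

namespace PrefixState

/-- `H` is the prefix of the right-hand side under construction in the state `q`, and `N` is the
nonterminal to be appended to it, if any. -/
def Split (q : G.PrefixState) (H N : List (Symbol T G.NT)) : Prop :=
  (¬ q.IsReduced ∧ H = q.current ∧ N = []) ∨ (q.IsReduced ∧ H = q.suspended ∧ N = q.current)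

theorem not_isReduced_of_eq_append {q : G.PrefixState} {v : List (Symbol T G.NT)} {a : T}
    (h : q.current = v ++ [Symbol.terminal a]) : ¬ q.IsReduced := by
  rintro ⟨B, hB⟩
  rw [h] at hB
  rcases v with _ | ⟨s, v⟩ <;> simp at hB

theorem split_of_eq_append {q : G.PrefixState} {v : List (Symbol T G.NT)} {a : T}
    (h : q.current = v ++ [Symbol.terminal a]) : q.Split (v ++ [Symbol.terminal a]) [] :=
  Or.inl ⟨not_isReduced_of_eq_append h, h.symm, rfl⟩

theorem Split.push {p q : G.PrefixState} {H N : List (Symbol T G.NT)} (hp : p.Split H N) {a : T}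
    (h : (G.prefixAutomaton M).push p a q) : q.current = N ++ [Symbol.terminal a] := by
  rcases hp with ⟨hp, rfl, rfl⟩ | ⟨hp, rfl, rfl⟩ <;> rcases h with ⟨h, h', -⟩ | ⟨h, h', -⟩
  · exact h'
  · exact absurd h hp
  · exact absurd hp h
  · exact h'

theorem Split.shift {p q : G.PrefixState} {H N : List (Symbol T G.NT)} (hp : p.Split H N) {a : T}
    (h : (G.prefixAutomaton M).shift p a q) : q.current = H ++ N ++ [Symbol.terminal a] := by
  rcases hp with ⟨hp, rfl, rfl⟩ | ⟨hp, rfl, rfl⟩ <;> rcases h with ⟨h, h', -⟩ | ⟨h, h', -⟩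
  · simpa using h'
  · exact absurd h hp
  · exact absurd hp h
  · exact h'

theorem Split.pop {p s q : G.PrefixState} {H N H' N' : List (Symbol T G.NT)} (hp : p.Split H N)
    (hs : s.Split H' N') (h : (G.prefixAutomaton M).pop p s q) :
    ∃ A, ⟨A, H ++ N⟩ ∈ G.rules ∧ q.Split H' [Symbol.nonterminal A] := by
  obtain ⟨A, hA, h₁, h₂⟩ := h
  refine ⟨A, ?_, Or.inr ⟨⟨A, hA⟩, ?_, hA.symm⟩⟩
  · rcases hp with ⟨hp, rfl, rfl⟩ | ⟨hp, rfl, rfl⟩ <;> rcases h₁ with ⟨h, h'⟩ | ⟨h, h'⟩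
    · simpa using h'
    · exact absurd h hp
    · exact absurd hp h
    · exact h'
  · rcases hs with ⟨hs, rfl, rfl⟩ | ⟨hs, rfl, rfl⟩ <;> rcases h₂ with ⟨h, h'⟩ | ⟨h, h'⟩
    · exact h'.symm
    · exact absurd h hs
    · exact absurd hs h
    · exact h'.symm

end PrefixState

/-! ### The automaton accepts only words of the grammar -/

/-- `StackYield s H x`: the prefixes of right-hand sides stored in the stack `s`, followed by `H`,
derive the word `x`. -/
inductive StackYield : List (T × G.PrefixState) → List (Symbol T G.NT) → List T → Prop
  | nil : StackYield [] [] []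
  -- The nonterminal `N` pending in `p` does not count here: the push has made it the first symbol
  -- of `H'`.
  | cons {s : List (T × G.PrefixState)} {H N H' : List (Symbol T G.NT)} {x y : List T}
      {p : G.PrefixState} (a : T) : StackYield s H x → p.Split H N → Yield G.Gen H' y →
      StackYield ((a, p) :: s) H' (x ++ y)

/-- The word `x` read so far is derived from the state and the stack. -/
def Reads (q : G.PrefixState) (s : List (T × G.PrefixState)) (x : List T) : Prop :=
  ∃ H N y z, x = y ++ z ∧ StackYield s H y ∧ q.Split H N ∧ Yield G.Gen N z

/-- A push or shift only moves the pending nonterminal and the new terminal into the prefix on top.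
A pop is the one move that needs a rule: the top prefix and the pending nonterminal together are its
right-hand side, and the left-hand side becomes pending after the prefix below. -/
theorem Reads.move {c d : OPAConfig T G.PrefixState} (h : (G.prefixAutomaton M).Move c d)
    {w x : List T} (hw : w = x ++ c.input) (hx : Reads c.state c.stack x) :
    ∃ x', w = x' ++ d.input ∧ Reads d.state d.stack x' := by
  obtain ⟨H, N, y, z, rfl, hs, hq, hz⟩ := hx
  subst hw
  cases h with
  | push a u p q s h hδ =>
    exact ⟨y ++ z ++ [a], by simp, _, [], y ++ (z ++ [a]), [], by simp,
      .cons a hs hq (hz.append (.singleton_terminal a)),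
      PrefixState.split_of_eq_append (hq.push hδ), .nil⟩
  | shift a b u p q r s h hδ =>
    cases hs with
    | @cons _ _ _ _ x₁ y₁ _ _ hs hp hy =>
      exact ⟨x₁ ++ y₁ ++ z ++ [b], by simp, _, [], x₁ ++ (y₁ ++ z ++ [b]), [], by simp,
        .cons b hs hp ((hy.append hz).append (.singleton_terminal b)),
        PrefixState.split_of_eq_append (hq.shift hδ), .nil⟩
  | pop a u p q r s h hδ =>
    cases hs with
    | cons _ hs hp hy =>
      obtain ⟨A, hA, hr⟩ := hq.pop hp hδ
      exact ⟨_, rfl, _, _, _, _, List.append_assoc _ _ _, hs, hr,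
        .singleton (gen_of_rule hA (hy.append hz))⟩

theorem language_prefixAutomaton_le : ∀ x ∈ (G.prefixAutomaton M).language, x ∈ G.language := by
  rintro x ⟨i, ⟨hi₁, hi₂⟩, f, ⟨hf₁, hf₂⟩, hrun⟩
  have hi : ¬ i.IsReduced := by
    rintro ⟨B, hB⟩
    simp [hi₁] at hB
  have key : ∀ d, Relation.ReflTransGen (G.prefixAutomaton M).Move ⟨x, i, []⟩ d →
      ∃ x', x = x' ++ d.input ∧ Reads d.state d.stack x' := by
    intro d hd
    induction hd with
    | refl => exact ⟨[], rfl, [], [], [], [], rfl, .nil, Or.inl ⟨hi, hi₁.symm, rfl⟩, .nil⟩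
    | tail _ h ih =>
      obtain ⟨x', hx', hr⟩ := ih
      exact hr.move h hx'
  obtain ⟨x', hx', H, N, y, z, rfl, hs, hq, hz⟩ := key _ hrun
  -- The empty stack leaves no prefix, so the whole word comes from the pending part `N`.
  cases hs
  simp only [List.nil_append, List.append_nil] at hx'
  subst hx'
  rcases hf₂ with ⟨hf, hr⟩ | ⟨A, hA, hr⟩
  · rcases hq with ⟨-, -, rfl⟩ | ⟨⟨B, hB⟩, -⟩
    · cases hz
      exact derives_rule hr
    · simp [hf] at hB
  · rcases hq with ⟨h, -⟩ | ⟨-, -, rfl⟩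
    · exact absurd ⟨A, hA⟩ h
    · rw [hA] at hz
      rcases hr with rfl | hr
      · exact hz.of_singleton
      · exact gen_of_rule hr hz

/-! ### The automaton accepts all words of the grammar -/

/-- Started before the word `x` in a context that is compatible with `A`, the automaton built from
`G` can reduce `x` to `A`. -/
def ReducesTo (G : ContextFreeGrammar T) (M : OPM T) (A : G.NT) (x : List T) : Prop :=
  ∀ (p q : G.PrefixState) (s : List (T × G.PrefixState)) (y : List T), ¬ p.IsReduced →
    (∀ a ∈ G.leftTerminals A, M.rel (OPA.topSymbol s) (some a) = some Prec.yields) →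
    (∀ a ∈ G.rightTerminals A, M.rel (some a) y.head? = some Prec.takes) →
    q.current = [Symbol.nonterminal A] → q.suspended = p.current →
    Relation.ReflTransGen (G.prefixAutomaton M).Move ⟨x ++ y, p, s⟩ ⟨y, q, s⟩

/-- The first component of a state that is not reduced may become a second component. -/
theorem PrefixState.suspendable {p : G.PrefixState} (hp : ¬ p.IsReduced) :
    p.current = [] ∨ p.current ∈ G.rhsPrefixes := by
  rcases p.current_mem with h | h | h
  · exact Or.inl h
  · exact Or.inr h
  · exact absurd h hp

theorem head_yields_of_rule (hM : G.OPMSubset M) {A : G.NT} {γ β : List (Symbol T G.NT)} {a : T}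
    {D : G.NT} (h : ⟨A, γ ++ Symbol.terminal a :: Symbol.nonterminal D :: β⟩ ∈ G.rules) :
    ∀ b ∈ G.leftTerminals D, M.rel (some a) (some b) = some Prec.yields :=
  fun b hb => hM a b Prec.yields ⟨_, h, γ, β, D, rfl, hb⟩

/-- Completing a right-hand side of which a prefix ending with a terminal has been built. -/
theorem run_suffix (hG : G.IsOperatorGrammar) (hM : G.OPMSubset M) {A : G.NT}
    {v : List (Symbol T G.NT)} {z : List T} (hz : Yield (G.ReducesTo M) v z) :
    ∀ {γ : List (Symbol T G.NT)} {a : T} {p q q' : G.PrefixState} {s : List (T × G.PrefixState)}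
      {y : List T}, ⟨A, γ ++ Symbol.terminal a :: v⟩ ∈ G.rules →
      q.current = γ ++ [Symbol.terminal a] →
      (∀ a ∈ G.rightTerminals A, M.rel (some a) y.head? = some Prec.takes) →
      q'.current = [Symbol.nonterminal A] →
      ((¬ p.IsReduced ∧ q'.suspended = p.current) ∨ (p.IsReduced ∧ q'.suspended = p.suspended)) →
      Relation.ReflTransGen (G.prefixAutomaton M).Move ⟨z ++ y, q, (a, p) :: s⟩ ⟨y, q', s⟩ := by
  -- The induction is strong because a nonterminal is consumed together with the terminal after it.
  induction hn : v.length using Nat.strong_induction_on generalizing v z with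
  | _ n ih =>
  subst hn
  intro γ a p q q' s y hr hq hy hq' hp
  have hqr : ¬ q.IsReduced := PrefixState.not_isReduced_of_eq_append hq
  cases hz with
  | nil =>
    refine .single (.pop a y p q q' s (hy a ⟨none, γ, derives_rule hr⟩)
      ⟨A, hq', Or.inl ⟨hqr, ?_⟩, hp⟩)
    rwa [hq]
  | @terminal b v z hz =>
    have hab : M.rel (some a) (some b) = some Prec.equal :=
      hM a b Prec.equal ⟨_, hr, γ, v, none, rfl⟩
    have hr' : ⟨A, (γ ++ [Symbol.terminal a]) ++ Symbol.terminal b :: v⟩ ∈ G.rules := by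
      simpa using hr
    let q₁ : G.PrefixState := ⟨γ ++ [Symbol.terminal a] ++ [Symbol.terminal b], q.suspended,
      Or.inr (Or.inl ⟨⟨_, hr', v, by simp⟩, _, b, rfl⟩), q.suspended_mem⟩
    refine .head (.shift a b (z ++ y) p q q₁ s hab (Or.inl ⟨hqr, ?_, rfl⟩))
      (ih v.length (by simp) hz rfl hr' rfl hy hq' hp)
    rw [hq]
  | @nonterminal B v z x hB hz =>
    let q₁ : G.PrefixState := ⟨[Symbol.nonterminal B], q.current, Or.inr (Or.inr ⟨B, rfl⟩),
      PrefixState.suspendable hqr⟩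
    have hq₁ : q₁.IsReduced := ⟨B, rfl⟩
    have hl := head_yields_of_rule hM hr
    cases hz with
    | nil =>
      have hr' : ⟨A, (γ ++ [Symbol.terminal a]) ++ [Symbol.nonterminal B]⟩ ∈ G.rules := by
        simpa using hr
      have h₁ := hB q q₁ ((a, p) :: s) y hqr hl
        (fun b hb => hy b (rightTerminals_subset_of_rule hr' hb)) rfl rfl
      rw [List.append_nil]
      refine h₁.tail (.pop a y p q₁ q' s ?_ ⟨A, hq', Or.inr ⟨hq₁, ?_⟩, hp⟩)
      · exact hy a ⟨some B, γ, derives_rule hr⟩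
      · simpa only [q₁, hq] using hr'
    | @terminal b v z hz =>
      have hab : M.rel (some a) (some b) = some Prec.equal :=
        hM a b Prec.equal ⟨_, hr, γ, v, some B, rfl⟩
      have hr' : ⟨A, (γ ++ [Symbol.terminal a, Symbol.nonterminal B]) ++ Symbol.terminal b :: v⟩
        ∈ G.rules := by simpa using hr
      -- The second component may be dropped here: the prefix to be resumed after the final pop is
      -- read off the popped state `p`.
      let q₂ : G.PrefixState := ⟨γ ++ [Symbol.terminal a, Symbol.nonterminal B] ++
        [Symbol.terminal b], [], Or.inr (Or.inl ⟨⟨_, hr', v, by simp⟩, _, b, rfl⟩), Or.inl rfl⟩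
      have h₁ := hB q q₁ ((a, p) :: s) (b :: (z ++ y)) hqr hl
        (fun c hc => hM c b Prec.takes
          ⟨_, hr, γ ++ [Symbol.terminal a], v, B, by simp, hc⟩) rfl rfl
      simp only [List.append_assoc, List.cons_append]
      refine h₁.trans (.head (.shift a b (z ++ y) p q₁ q₂ s hab (Or.inr ⟨hq₁, ?_, rfl⟩))
        (ih v.length (by simp) hz rfl hr' rfl hy hq' hp))
      simp [q₁, q₂, hq]
    | @nonterminal C v z x hC hz =>
      exact absurd (by simp) (hG _ hr (γ ++ [Symbol.terminal a]) v B C)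

/-- A leading nonterminal is reduced before the push, while the prefix of the surrounding right-hand
side is suspended. The pushed state then holds that prefix as its second component, from which the
final pop recovers it; without a leading nonterminal it is the first component. -/
theorem reducesTo_of_rule (hG : G.IsOperatorGrammar) (hM : G.OPMSubset M) {A : G.NT}
    {v : List (Symbol T G.NT)} {x : List T} (hr : ⟨A, v⟩ ∈ G.rules)
    (hv : ¬ G.IsEmptyOrRenaming ⟨A, v⟩) (hx : Yield (G.ReducesTo M) v x) : G.ReducesTo M A x := by
  intro p q s y hp hl hy hq hqp
  obtain ⟨B, a, w, rfl⟩ := exists_first_terminal (hG _ hr) (fun h => hv (Or.inl h))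
    (fun B h => hv (Or.inr ⟨B, h⟩))
  have ha : M.rel (OPA.topSymbol s) (some a) = some Prec.yields := hl a ⟨B, w, derives_rule hr⟩
  obtain _ | B := B
  · cases hx with
    | @terminal _ _ z hz =>
      have hr' : ⟨A, [] ++ Symbol.terminal a :: w⟩ ∈ G.rules := hr
      let q₁ : G.PrefixState := ⟨[Symbol.terminal a], [],
        Or.inr (Or.inl ⟨⟨_, hr', w, rfl⟩, [], a, rfl⟩), Or.inl rfl⟩
      exact .head (.push a (z ++ y) p q₁ s ha (Or.inl ⟨hp, rfl, rfl⟩))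
        (run_suffix hG hM hz hr' rfl hy hq (Or.inl ⟨hp, hqp⟩))
  · cases hx with
    | @nonterminal _ _ z x hB hz =>
    cases hz with
    | @terminal _ _ z hz =>
      have hr' : ⟨A, [Symbol.nonterminal B] ++ Symbol.terminal a :: w⟩ ∈ G.rules := hr
      let p₁ : G.PrefixState := ⟨[Symbol.nonterminal B], p.current, Or.inr (Or.inr ⟨B, rfl⟩),
        PrefixState.suspendable hp⟩
      let q₁ : G.PrefixState := ⟨[Symbol.nonterminal B, Symbol.terminal a], p.current,
        Or.inr (Or.inl ⟨⟨_, hr', w, rfl⟩, [Symbol.nonterminal B], a, rfl⟩),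
        PrefixState.suspendable hp⟩
      have h₁ := hB p p₁ s (a :: (z ++ y)) hp
        (fun b hb => hl b (leftTerminals_subset_of_rule hr hb))
        (fun c hc => hM c a Prec.takes ⟨_, hr, [], w, B, rfl, hc⟩) rfl rfl
      rw [List.append_assoc]
      exact h₁.trans (.head (.push a (z ++ y) p₁ q₁ s ha (Or.inr ⟨⟨B, rfl⟩, rfl, rfl⟩))
        (run_suffix hG hM hz hr' rfl hy hq (Or.inr ⟨⟨B, rfl⟩, hqp⟩)))

/-- No empty or renaming rule has the left-hand side `A`. -/
def IsProper (G : ContextFreeGrammar T) (A : G.NT) : Prop :=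
  ∀ v, ⟨A, v⟩ ∈ G.rules → ¬ G.IsEmptyOrRenaming ⟨A, v⟩

theorem isProper_of_mem (h₁ : G.OnlyAxiomEmptyOrRenaming) (h₂ : G.AxiomIsolated) {A B : G.NT}
    {v : List (Symbol T G.NT)} (hr : ⟨A, v⟩ ∈ G.rules) (hB : Symbol.nonterminal B ∈ v) :
    G.IsProper B := by
  intro w hw hw'
  obtain rfl : B = G.initial := h₁ _ hw hw'
  exact h₂ ⟨_, hw, rfl, hw'⟩ _ hr hB

/-- Nonterminals inside right-hand sides are proper, so the induction never descends into an empty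
or renaming rule. -/
theorem reducesTo_of_gen (hG : G.IsOperatorGrammar) (hM : G.OPMSubset M)
    (h₁ : G.OnlyAxiomEmptyOrRenaming) (h₂ : G.AxiomIsolated) {A : G.NT} {x : List T}
    (h : G.Gen A x) : G.IsProper A → G.ReducesTo M A x := by
  refine Gen.induction (R := fun A x => G.IsProper A → G.ReducesTo M A x) ?_ h
  intro A v x hr hx hA
  exact reducesTo_of_rule hG hM hr (hA v hr)
    (hx.mono fun B y hB h => h.2 (isProper_of_mem h₁ h₂ hr hB))

theorem le_language_prefixAutomaton (hG : G.IsOperatorGrammar) (hM : G.OPMSubset M)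
    (h₁ : G.OnlyAxiomEmptyOrRenaming) (h₂ : G.AxiomIsolated) :
    ∀ x ∈ G.language, x ∈ (G.prefixAutomaton M).language := by
  intro x hx
  have hstart : ¬ PrefixState.IsReduced (G := G) ⟨[], [], Or.inl rfl, Or.inl rfl⟩ := by
    rintro ⟨B, hB⟩
    cases hB
  have key : ∀ A, (A = G.initial ∨ ⟨G.initial, [Symbol.nonterminal A]⟩ ∈ G.rules) →
      G.ReducesTo M A x → x ∈ (G.prefixAutomaton M).language := by
    intro A hA h
    refine ⟨⟨[], [], Or.inl rfl, Or.inl rfl⟩, ⟨rfl, rfl⟩,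
      ⟨[Symbol.nonterminal A], [], Or.inr (Or.inr ⟨A, rfl⟩), Or.inl rfl⟩,
      ⟨rfl, Or.inr ⟨A, rfl, hA⟩⟩, ?_⟩
    -- Both neighbours are the delimiter, so the context conditions hold by `# ⋖ a` and `a ⋗ #`.
    simpa using h ⟨[], [], Or.inl rfl, Or.inl rfl⟩
      ⟨[Symbol.nonterminal A], [], Or.inr (Or.inr ⟨A, rfl⟩), Or.inl rfl⟩ [] []
      hstart (fun _ _ => rfl) (fun _ _ => rfl) rfl rfl
  obtain ⟨v, hr, hv⟩ := Gen.exists_rule (A := G.initial) hx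
  have hv' := yield_gen_of_derives hv
  by_cases hbad : G.IsEmptyOrRenaming ⟨G.initial, v⟩
  · obtain rfl | ⟨B, rfl⟩ := hbad
    · cases hv'
      exact ⟨_, ⟨rfl, rfl⟩, ⟨[], [], Or.inl rfl, Or.inl rfl⟩, ⟨rfl, Or.inl ⟨rfl, hr⟩⟩, .refl⟩
    · exact key B (Or.inr hr) (reducesTo_of_gen hG hM h₁ h₂ hv'.of_singleton
        (isProper_of_mem h₁ h₂ hr (by simp)))
  · exact key _ (Or.inl rfl) (reducesTo_of_rule hG hM hr hbad (hv'.mono fun B y hB h =>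
      reducesTo_of_gen hG hM h₁ h₂ h (isProper_of_mem h₁ h₂ hr hB)))

theorem language_prefixAutomaton (hG : G.IsOperatorGrammar) (hM : G.OPMSubset M)
    (h₁ : G.OnlyAxiomEmptyOrRenaming) (h₂ : G.AxiomIsolated) :
    (G.prefixAutomaton M).language = G.language := by
  ext x
  exact ⟨language_prefixAutomaton_le x, le_language_prefixAutomaton hG hM h₁ h₂ x⟩

end ContextFreeGrammar

/-! ### Completion -/

namespace OPA

variable {T Q : Type*} {M : OPM T}

theorem completion_push_some (A : OPA M Q) (q : Option Q) (a : T) (r : Q) :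
    A.completion.push q a (some r) ↔ ∃ q₀, q = some q₀ ∧ A.push q₀ a r := by
  simp [completion]

theorem completion_shift_some (A : OPA M Q) (q : Option Q) (a : T) (r : Q) :
    A.completion.shift q a (some r) ↔ ∃ q₀, q = some q₀ ∧ A.shift q₀ a r := by
  simp [completion]

theorem completion_pop_some (A : OPA M Q) (q p : Option Q) (r : Q) :
    A.completion.pop q p (some r) ↔ ∃ q₀, q = some q₀ ∧ ∃ p₀, p = some p₀ ∧ A.pop q₀ p₀ r := by
  simp [completion]

/-- The sink is absorbing, also when it is stored in the stack: popping a stored sink leads to the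
sink. Hence a configuration free of it has only predecessors free of it. -/
theorem completion_reflects (A : OPA M Q) {C : OPAConfig T (Option Q)} {x : List T} {q : Q}
    {s : List (T × Q)}
    (h : A.completion.Move C ⟨x, some q, s.map (Prod.map id some)⟩) :
    ∃ (p : Q) (t : List (T × Q)), C.state = some p ∧ C.stack = t.map (Prod.map id some) ∧
      A.Move ⟨C.input, p, t⟩ ⟨x, q, s⟩ := by
  have htop : ∀ s : List (T × Q),
      topSymbol (s.map (Prod.map id (some : Q → Option Q))) = topSymbol s := by
    rintro (_ | ⟨⟨a, p⟩, s⟩) <;> rfl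
  generalize hS : s.map (Prod.map id some) = S at h
  generalize hq : some q = r at h
  cases h with
  | push a x p r s' h hδ =>
    subst hq
    obtain ⟨p, rfl, hδ'⟩ := (A.completion_push_some _ _ _).mp hδ
    rcases s with _ | ⟨⟨b, p'⟩, s⟩
    · simp at hS
    · simp only [List.map_cons, Prod.map_apply, id_eq, List.cons.injEq, Prod.mk.injEq,
        Option.some.injEq] at hS
      obtain ⟨⟨rfl, rfl⟩, rfl⟩ := hS
      exact ⟨_, _, rfl, rfl, .push b x _ _ _ (htop s ▸ h) hδ'⟩
  | shift a b x p q' r s' h hδ =>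
    subst hq
    obtain ⟨p, rfl, hδ'⟩ := (A.completion_shift_some _ _ _).mp hδ
    rcases s with _ | ⟨⟨c, p'⟩, s⟩
    · simp at hS
    · simp only [List.map_cons, Prod.map_apply, id_eq, List.cons.injEq, Prod.mk.injEq] at hS
      obtain ⟨⟨rfl, rfl⟩, rfl⟩ := hS
      exact ⟨_, (a, p') :: s, rfl, rfl, .shift a c x _ _ _ _ h hδ'⟩
  | pop a x p q' r s' h hδ =>
    subst hq hS
    obtain ⟨q', rfl, p, rfl, hδ'⟩ := (A.completion_pop_some _ _ _).mp hδ
    exact ⟨_, (a, p) :: s, rfl, rfl, .pop a _ _ _ _ _ h hδ'⟩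

theorem language_completion (A : OPA M Q) : A.completion.language = A.language := by
  ext x
  constructor
  · rintro ⟨_, ⟨i, hi, rfl⟩, _, ⟨f, hf, rfl⟩, h⟩
    have key : ∀ C D : OPAConfig T (Option Q), Relation.ReflTransGen A.completion.Move C D →
        ∀ q s, D.state = some q → D.stack = s.map (Prod.map id some) →
          ∃ p t, C.state = some p ∧ C.stack = t.map (Prod.map id some) ∧
            Relation.ReflTransGen A.Move ⟨C.input, p, t⟩ ⟨D.input, q, s⟩ := by
      intro C D h
      induction h with
      | refl => exact fun q s hq hs => ⟨q, s, hq, hs, .refl⟩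
      | @tail D E _ h ih =>
        obtain ⟨x, r, S⟩ := E
        rintro q s rfl rfl
        obtain ⟨p, t, hp, ht, h₁⟩ := A.completion_reflects h
        obtain ⟨p', t', hp', ht', h₂⟩ := ih p t hp ht
        exact ⟨p', t', hp', ht', h₂.tail h₁⟩
    obtain ⟨p, t, hp, ht, hrun⟩ := key _ _ h f [] rfl rfl
    simp only [Option.some.injEq, List.nil_eq, List.map_eq_nil_iff] at hp ht
    subst hp ht
    exact ⟨i, hi, f, hf, hrun⟩
  · exact language_le_of_map (B := A.completion) some (fun q h => ⟨q, h, rfl⟩)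
      (fun q h => ⟨q, h, rfl⟩)
      (fun p a q h => (A.completion_push_some _ _ _).mpr ⟨p, rfl, h⟩)
      (fun p a q h => (A.completion_shift_some _ _ _).mpr ⟨p, rfl, h⟩)
      (fun p s q h => (A.completion_pop_some _ _ _).mpr ⟨p, rfl, s, rfl, h⟩) x

theorem isDeterministic_completion (A : OPA M Q) (hinitial : ∃ i, A.initial = {i})
    (hpush : ∀ q a r r', A.push q a r → A.push q a r' → r = r')
    (hshift : ∀ q a r r', A.shift q a r → A.shift q a r' → r = r')
    (hpop : ∀ q p r r', A.pop q p r → A.pop q p r' → r = r') :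
    A.completion.IsDeterministic where
  initial_singleton := by
    obtain ⟨i, hi⟩ := hinitial
    exact ⟨some i, by simp [completion, hi]⟩
  push_function q a := by
    by_cases h : ∃ r, A.completion.push q a (some r)
    · obtain ⟨r, hr⟩ := h
      refine ⟨some r, hr, ?_⟩
      obtain ⟨q, rfl, hr'⟩ := (A.completion_push_some _ _ _).mp hr
      rintro _ (⟨q₀, r₀, hq, rfl, h⟩ | ⟨rfl, h⟩)
      · cases hq
        rw [hpush _ _ _ _ h hr']
      · exact absurd hr' (h _ _ rfl)
    · refine ⟨none, Or.inr ⟨rfl, fun q₀ r₀ hq hr => h ⟨r₀, ?_⟩⟩, ?_⟩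
      · exact (A.completion_push_some _ _ _).mpr ⟨q₀, hq, hr⟩
      · rintro (_ | r) hr
        · rfl
        · exact absurd ⟨r, hr⟩ h
  shift_function q a := by
    by_cases h : ∃ r, A.completion.shift q a (some r)
    · obtain ⟨r, hr⟩ := h
      refine ⟨some r, hr, ?_⟩
      obtain ⟨q, rfl, hr'⟩ := (A.completion_shift_some _ _ _).mp hr
      rintro _ (⟨q₀, r₀, hq, rfl, h⟩ | ⟨rfl, h⟩)
      · cases hq
        rw [hshift _ _ _ _ h hr']
      · exact absurd hr' (h _ _ rfl)
    · refine ⟨none, Or.inr ⟨rfl, fun q₀ r₀ hq hr => h ⟨r₀, ?_⟩⟩, ?_⟩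
      · exact (A.completion_shift_some _ _ _).mpr ⟨q₀, hq, hr⟩
      · rintro (_ | r) hr
        · rfl
        · exact absurd ⟨r, hr⟩ h
  pop_function q p := by
    by_cases h : ∃ r, A.completion.pop q p (some r)
    · obtain ⟨r, hr⟩ := h
      refine ⟨some r, hr, ?_⟩
      obtain ⟨q, rfl, p, rfl, hr'⟩ := (A.completion_pop_some _ _ _).mp hr
      rintro _ (⟨q₀, p₀, r₀, hq, hp, rfl, h⟩ | ⟨rfl, h⟩)
      · cases hq
        cases hp
        rw [hpop _ _ _ _ h hr']
      · exact absurd hr' (h _ _ _ rfl rfl)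
    · refine ⟨none, Or.inr ⟨rfl, fun q₀ p₀ r₀ hq hp hr => h ⟨r₀, ?_⟩⟩, ?_⟩
      · exact (A.completion_pop_some _ _ _).mpr ⟨q₀, hq, p₀, hp, hr⟩
      · rintro (_ | r) hr
        · rfl
        · exact absurd ⟨r, hr⟩ h

end OPA

/-- Push and shift prescribe both components of the target. Only a pop has a choice, that of a
left-hand side for the completed right-hand side, and invertibility removes it. -/
theorem ContextFreeGrammar.isDeterministic_completion_prefixAutomaton {T : Type*}
    {G : ContextFreeGrammar T} (M : OPM T) (hG : G.IsInvertible) :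
    (G.prefixAutomaton M).completion.IsDeterministic := by
  refine OPA.isDeterministic_completion _ ⟨⟨[], [], Or.inl rfl, Or.inl rfl⟩, ?_⟩ ?_ ?_ ?_
  · ext q
    exact ⟨fun h => PrefixState.ext h.1 h.2, by rintro rfl; exact ⟨rfl, rfl⟩⟩
  · rintro q a r r' (⟨h, h₁, h₂⟩ | ⟨h, h₁, h₂⟩) (⟨h', h₁', h₂'⟩ | ⟨h', h₁', h₂'⟩)
    · exact PrefixState.ext (h₁.trans h₁'.symm) (h₂.trans h₂'.symm)
    · exact absurd h' h
    · exact absurd h h'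
    · exact PrefixState.ext (h₁.trans h₁'.symm) (h₂.trans h₂'.symm)
  · rintro q a r r' (⟨h, h₁, h₂⟩ | ⟨h, h₁, h₂⟩) (⟨h', h₁', h₂'⟩ | ⟨h', h₁', h₂'⟩)
    · exact PrefixState.ext (h₁.trans h₁'.symm) (h₂.trans h₂'.symm)
    · exact absurd h' h
    · exact absurd h h'
    · exact PrefixState.ext (h₁.trans h₁'.symm) (h₂.trans h₂'.symm)
  · rintro q p r r' ⟨A, hA, h₁, h₂⟩ ⟨A', hA', h₁', h₂'⟩
    refine PrefixState.ext ?_ ?_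
    · rw [hA, hA']
      rcases h₁ with ⟨h, h₁⟩ | ⟨h, h₁⟩ <;> rcases h₁' with ⟨h', h₁'⟩ | ⟨h', h₁'⟩
      · cases hG _ h₁ _ h₁' rfl
        rfl
      · exact absurd h' h
      · exact absurd h h'
      · cases hG _ h₁ _ h₁' rfl
        rfl
    · rcases h₂ with ⟨h, h₂⟩ | ⟨h, h₂⟩ <;> rcases h₂' with ⟨h', h₂'⟩ | ⟨h', h₂'⟩
      · exact h₂.trans h₂'.symm
      · exact absurd h' h
      · exact absurd h h'
      · exact h₂.trans h₂'.symm

/-! ### Elimination of empty and renaming rules -/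

/-- `Erasure v w`: `w` is obtained from `v` by deleting some nonterminals. -/
inductive Erasure {T N : Type*} : List (Symbol T N) → List (Symbol T N) → Prop
  | nil : Erasure [] []
  | cons (s : Symbol T N) {v w : List (Symbol T N)} : Erasure v w → Erasure (s :: v) (s :: w)
  | erase (B : N) {v w : List (Symbol T N)} :
      Erasure v w → Erasure (Symbol.nonterminal B :: v) w

namespace Erasure

variable {T N : Type*} {v w w₁ w₂ : List (Symbol T N)}

theorem sublist (h : Erasure v w) : w.Sublist v := by
  induction h with
  | nil => exact List.Sublist.refl _
  | cons s _ ih => exact ih.cons_cons s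
  | erase B _ ih => exact ih.cons _

theorem exists_of_append (h : Erasure v (w₁ ++ w₂)) :
    ∃ v₁ v₂, v = v₁ ++ v₂ ∧ Erasure v₁ w₁ ∧ Erasure v₂ w₂ := by
  generalize hw : w₁ ++ w₂ = w at h
  induction h generalizing w₁ with
  | nil =>
    obtain ⟨rfl, rfl⟩ := List.append_eq_nil_iff.mp hw
    exact ⟨[], [], rfl, nil, nil⟩
  | @cons s v w h ih =>
    rcases w₁ with _ | ⟨s', w₁⟩
    · rw [List.nil_append] at hw
      exact ⟨[], s :: v, rfl, nil, hw ▸ cons s h⟩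
    · rw [List.cons_append] at hw
      obtain ⟨rfl, hw'⟩ := List.cons.inj hw
      obtain ⟨v₁, v₂, rfl, h₁, h₂⟩ := ih hw'
      exact ⟨s' :: v₁, v₂, rfl, cons s' h₁, h₂⟩
  | erase B _ ih =>
    obtain ⟨v₁, v₂, rfl, h₁, h₂⟩ := ih hw
    exact ⟨_ :: v₁, v₂, rfl, erase B h₁, h₂⟩

theorem exists_of_cons {s : Symbol T N} (h : Erasure v (s :: w)) :
    ∃ (m : List N) (v' : List (Symbol T N)), v = m.map Symbol.nonterminal ++ s :: v' ∧
      Erasure v' w := by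
  generalize hw : s :: w = w' at h
  induction h with
  | nil => cases hw
  | cons s h _ =>
    cases hw
    exact ⟨[], _, rfl, h⟩
  | erase B _ ih =>
    obtain ⟨m, v', rfl, h⟩ := ih hw
    exact ⟨B :: m, v', rfl, h⟩

end Erasure

namespace ContextFreeGrammar

variable {T : Type*} {G : ContextFreeGrammar T} {M : OPM T}

/-! ### Erasures of right-hand sides in operator form -/

theorem nonterminals_eq_optNT {α m' : List (Symbol T G.NT)} {m : List G.NT}
    (h : ∀ (γ β : List (Symbol T G.NT)) (B C : G.NT), α ++ (m.map Symbol.nonterminal ++ m') ≠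
      γ ++ Symbol.nonterminal B :: Symbol.nonterminal C :: β) :
    ∃ B, m.map Symbol.nonterminal = G.optNT B := by
  rcases m with _ | ⟨B, _ | ⟨C, m⟩⟩
  · exact ⟨none, rfl⟩
  · exact ⟨some B, rfl⟩
  · exact absurd (by simp) (h α (m.map Symbol.nonterminal ++ m') B C)

theorem nonterminals_eq_nil_of_left {α m' : List (Symbol T G.NT)} {m : List G.NT} {D : G.NT}
    (h : ∀ (γ β : List (Symbol T G.NT)) (B C : G.NT),
      α ++ Symbol.nonterminal D :: (m.map Symbol.nonterminal ++ m') ≠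
      γ ++ Symbol.nonterminal B :: Symbol.nonterminal C :: β) : m = [] := by
  rcases m with _ | ⟨C, m⟩
  · rfl
  · exact absurd (by simp) (h α (m.map Symbol.nonterminal ++ m') D C)

theorem nonterminals_eq_nil_of_right {α m' : List (Symbol T G.NT)} {m : List G.NT} {D : G.NT}
    (h : ∀ (γ β : List (Symbol T G.NT)) (B C : G.NT),
      α ++ (m.map Symbol.nonterminal ++ Symbol.nonterminal D :: m') ≠
      γ ++ Symbol.nonterminal B :: Symbol.nonterminal C :: β) : m = [] := by
  rcases m with _ | ⟨C, _ | ⟨C', m⟩⟩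
  · rfl
  · exact absurd (by simp) (h α m' C D)
  · exact absurd (by simp) (h α (m.map Symbol.nonterminal ++ Symbol.nonterminal D :: m') C C')

/-- Symbols that become adjacent had only deleted nonterminals between them. Next to a nonterminal
nothing can have been deleted, so the pair was adjacent before. -/
theorem erasure_operator_form (hG : G.IsOperatorGrammar) {r : ContextFreeRule T G.NT}
    (hr : r ∈ G.rules) {w : List (Symbol T G.NT)} (hw : Erasure r.output w)
    (α β : List (Symbol T G.NT)) (B C : G.NT) :
    w ≠ α ++ Symbol.nonterminal B :: Symbol.nonterminal C :: β := by
  rintro rfl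
  obtain ⟨v₁, v₂, hv, -, h⟩ := hw.exists_of_append
  obtain ⟨m, v₃, rfl, h₁⟩ := h.exists_of_cons
  obtain ⟨m', v₄, rfl, -⟩ := h₁.exists_of_cons
  have hop := hG r hr
  rw [hv] at hop
  obtain rfl : m' = [] := nonterminals_eq_nil_of_left
    (α := v₁ ++ m.map Symbol.nonterminal) (D := B) (by simpa using hop)
  exact hop (v₁ ++ m.map Symbol.nonterminal) v₄ B C (by simp)

/-- Between two terminals at most one nonterminal can have been present, and `≐` admits it. -/
theorem erasure_hasPrec_equal (hG : G.IsOperatorGrammar) {r : ContextFreeRule T G.NT}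
    (hr : r ∈ G.rules) {α β : List (Symbol T G.NT)} {B : Option G.NT} {a b : T}
    (hw : Erasure r.output (α ++ Symbol.terminal a :: (G.optNT B ++ Symbol.terminal b :: β))) :
    G.HasPrec Prec.equal a b := by
  obtain ⟨v₁, v₂, hv, -, h⟩ := hw.exists_of_append
  obtain ⟨m, v₃, rfl, h₁⟩ := h.exists_of_cons
  have key : ∃ (m : List G.NT) (v₄ : List (Symbol T G.NT)),
      v₃ = m.map Symbol.nonterminal ++ Symbol.terminal b :: v₄ := by
    obtain _ | B := B
    · obtain ⟨m, v₄, rfl, -⟩ := h₁.exists_of_cons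
      exact ⟨m, v₄, rfl⟩
    · obtain ⟨m₁, v₄, rfl, h₂⟩ := h₁.exists_of_cons
      obtain ⟨m₂, v₅, rfl, -⟩ := h₂.exists_of_cons
      exact ⟨m₁ ++ B :: m₂, v₅, by simp⟩
  obtain ⟨m', v₄, rfl⟩ := key
  have hop := hG r hr
  rw [hv] at hop
  obtain ⟨C, hC⟩ := nonterminals_eq_optNT (m := m') (m' := Symbol.terminal b :: v₄)
    (α := v₁ ++ m.map Symbol.nonterminal ++ [Symbol.terminal a]) (by simpa using hop)
  exact ⟨r, hr, v₁ ++ m.map Symbol.nonterminal, v₄, C, by rw [hv, hC]; simp⟩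

theorem erasure_terminal_nonterminal (hG : G.IsOperatorGrammar) {r : ContextFreeRule T G.NT}
    (hr : r ∈ G.rules) {α β : List (Symbol T G.NT)} {D : G.NT} {a : T}
    (hw : Erasure r.output (α ++ Symbol.terminal a :: Symbol.nonterminal D :: β)) :
    ∃ α' β', r.output = α' ++ Symbol.terminal a :: Symbol.nonterminal D :: β' := by
  obtain ⟨v₁, v₂, hv, -, h⟩ := hw.exists_of_append
  obtain ⟨m, v₃, rfl, h₁⟩ := h.exists_of_cons
  obtain ⟨m', v₄, rfl, -⟩ := h₁.exists_of_cons
  have hop := hG r hr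
  rw [hv] at hop
  obtain rfl : m' = [] := nonterminals_eq_nil_of_right (D := D) (m' := v₄)
    (α := v₁ ++ m.map Symbol.nonterminal ++ [Symbol.terminal a]) (by simpa using hop)
  exact ⟨v₁ ++ m.map Symbol.nonterminal, v₄, by simp [hv]⟩

theorem erasure_nonterminal_terminal (hG : G.IsOperatorGrammar) {r : ContextFreeRule T G.NT}
    (hr : r ∈ G.rules) {α β : List (Symbol T G.NT)} {D : G.NT} {b : T}
    (hw : Erasure r.output (α ++ Symbol.nonterminal D :: Symbol.terminal b :: β)) :
    ∃ α' β', r.output = α' ++ Symbol.nonterminal D :: Symbol.terminal b :: β' := by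
  obtain ⟨v₁, v₂, hv, -, h⟩ := hw.exists_of_append
  obtain ⟨m, v₃, rfl, h₁⟩ := h.exists_of_cons
  obtain ⟨m', v₄, rfl, -⟩ := h₁.exists_of_cons
  have hop := hG r hr
  rw [hv] at hop
  obtain rfl : m' = [] := nonterminals_eq_nil_of_left (D := D) (m' := Symbol.terminal b :: v₄)
    (α := v₁ ++ m.map Symbol.nonterminal) (by simpa using hop)
  exact ⟨v₁ ++ m.map Symbol.nonterminal, v₄, by simp [hv]⟩

/-- The inclusion of the symbols in those with one additional nonterminal. -/
def liftSymbol {N : Type*} : Symbol T N → Symbol T (Option N)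
  | Symbol.terminal a => Symbol.terminal a
  | Symbol.nonterminal B => Symbol.nonterminal (some B)

/-- The additional nonterminal is identified with the axiom. -/
def unliftSymbol (G : ContextFreeGrammar T) : Symbol T (Option G.NT) → Symbol T G.NT
  | Symbol.terminal a => Symbol.terminal a
  | Symbol.nonterminal B => Symbol.nonterminal (B.getD G.initial)

theorem map_unliftSymbol_map_liftSymbol (w : List (Symbol T G.NT)) :
    (w.map liftSymbol).map G.unliftSymbol = w := by
  rw [List.map_map]
  refine (List.map_congr_left fun s _ => ?_).trans (List.map_id w)
  cases s <;> rfl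

/-- The rules of the grammar without empty and renaming rules: a new axiom, and for every
nonterminal the strings that are derived from it and arise from a right-hand side by deletion of
nonterminals. -/
def properRules (G : ContextFreeGrammar T) : Set (ContextFreeRule T (Option G.NT)) :=
  {r | (r = ⟨none, []⟩ ∧ G.Gen G.initial []) ∨
    r = ⟨none, [Symbol.nonterminal (some G.initial)]⟩ ∨
    ∃ (A : G.NT) (w : List (Symbol T G.NT)), r = ⟨some A, w.map liftSymbol⟩ ∧
      (∃ r' ∈ G.rules, Erasure r'.output w) ∧ G.Derives [Symbol.nonterminal A] w ∧
      w ≠ [] ∧ ∀ B, w ≠ [Symbol.nonterminal B]}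

theorem finite_properRules (G : ContextFreeGrammar T) [Finite G.NT] : G.properRules.Finite := by
  have h : {w | ∃ r ∈ G.rules, Erasure r.output w}.Finite := by
    refine Set.Finite.subset (Set.Finite.biUnion G.rules.finite_toSet
      fun r _ => r.output.sublists.finite_toSet) ?_
    rintro w ⟨r, hr, hw⟩
    simpa using ⟨r, hr, hw.sublist⟩
  refine Set.Finite.subset (((Set.finite_singleton ⟨none, []⟩).insert
    ⟨none, [Symbol.nonterminal (some G.initial)]⟩).union
    ((Set.finite_univ.prod h).image fun z : G.NT × List (Symbol T G.NT) =>
      (⟨some z.1, z.2.map liftSymbol⟩ : ContextFreeRule T (Option G.NT)))) ?_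
  rintro r (⟨rfl, -⟩ | rfl | ⟨A, w, rfl, hw, -⟩)
  · exact Or.inl (Or.inr rfl)
  · exact Or.inl (Or.inl rfl)
  · exact Or.inr ⟨(A, w), ⟨trivial, hw⟩, rfl⟩

/-- An equivalent grammar in which only the axiom has empty and renaming rules. -/
noncomputable abbrev proper (G : ContextFreeGrammar T) [Finite G.NT] : ContextFreeGrammar T where
  NT := Option G.NT
  initial := none
  rules := G.finite_properRules.toFinset

/-! ### Precedence relations and language of the proper grammar -/

section Proper

variable [Finite G.NT]

theorem mem_rules_proper {r : ContextFreeRule T (Option G.NT)} :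
    r ∈ G.proper.rules ↔ r ∈ G.properRules :=
  Set.Finite.mem_toFinset _

/-- Every new rule is a derivation of `G` once the new axiom is identified with the old one. This
bounds both the terminal sets and the language of the new grammar. -/
theorem derives_unliftSymbol {u v : List (Symbol T (Option G.NT))} (h : G.proper.Derives u v) :
    G.Derives (u.map G.unliftSymbol) (v.map G.unliftSymbol) := by
  induction h with
  | refl => exact Derives.refl _
  | tail _ h ih =>
    refine ih.trans ?_
    obtain ⟨r, hr, h⟩ := h
    obtain ⟨p, q, rfl, rfl⟩ := h.exists_parts
    simp only [List.map_append, List.map_cons, List.map_nil]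
    refine ((Derives.append_left ?_ _).append_right _)
    rcases mem_rules_proper.mp hr with ⟨rfl, hd⟩ | rfl | ⟨A, w, rfl, -, hd, -⟩
    · exact hd
    · exact Derives.refl _
    · rw [map_unliftSymbol_map_liftSymbol]
      exact hd

theorem map_unliftSymbol_optNT (B : Option (Option G.NT)) :
    (G.proper.optNT B).map G.unliftSymbol = G.optNT (B.map fun C => C.getD G.initial) := by
  cases B <;> rfl

theorem leftTerminals_proper (D : Option G.NT) :
    G.proper.leftTerminals D ⊆ G.leftTerminals (D.getD G.initial) := by
  rintro a ⟨B, α, h⟩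
  refine ⟨B.map fun C => C.getD G.initial, α.map G.unliftSymbol, ?_⟩
  have := derives_unliftSymbol h
  rw [List.map_append, map_unliftSymbol_optNT] at this
  exact this

theorem rightTerminals_proper (D : Option G.NT) :
    G.proper.rightTerminals D ⊆ G.rightTerminals (D.getD G.initial) := by
  rintro a ⟨B, α, h⟩
  refine ⟨B.map fun C => C.getD G.initial, α.map G.unliftSymbol, ?_⟩
  have := derives_unliftSymbol h
  rw [List.map_append, List.map_cons, List.map_cons, map_unliftSymbol_optNT] at this
  exact this

/-- A right-hand side that contains a terminal is, up to the inclusion of the nonterminals, an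
erasure of a right-hand side of the original grammar. -/
theorem exists_erasure_of_mem_proper {r : ContextFreeRule T (Option G.NT)}
    (hr : r ∈ G.proper.rules) (h : 2 ≤ r.output.length) :
    ∃ r' ∈ G.rules, Erasure r'.output (r.output.map G.unliftSymbol) := by
  rcases mem_rules_proper.mp hr with ⟨rfl, -⟩ | rfl | ⟨A, w, rfl, hw, -⟩
  · simp at h
  · simp at h
  · simpa only [map_unliftSymbol_map_liftSymbol] using hw

theorem hasPrec_of_proper (hG : G.IsOperatorGrammar) {p : Prec} {a b : T}
    (h : G.proper.HasPrec p a b) : G.HasPrec p a b := by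
  cases p with
  | yields =>
    obtain ⟨r, hr, α, β, D, ho, hb⟩ := h
    obtain ⟨r', hr', he⟩ := exists_erasure_of_mem_proper hr (by simp [ho]; omega)
    rw [ho, List.map_append] at he
    obtain ⟨α', β', hv⟩ := erasure_terminal_nonterminal hG hr' he
    exact ⟨r', hr', α', β', _, hv, leftTerminals_proper D hb⟩
  | equal =>
    obtain ⟨r, hr, α, β, B, ho⟩ := h
    obtain ⟨r', hr', he⟩ := exists_erasure_of_mem_proper hr (by simp [ho]; omega)
    rw [ho, List.map_append, List.map_cons, List.map_append, map_unliftSymbol_optNT] at he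
    exact erasure_hasPrec_equal hG hr' he
  | takes =>
    obtain ⟨r, hr, α, β, D, ho, ha⟩ := h
    obtain ⟨r', hr', he⟩ := exists_erasure_of_mem_proper hr (by simp [ho]; omega)
    rw [ho, List.map_append] at he
    obtain ⟨α', β', hv⟩ := erasure_nonterminal_terminal hG hr' he
    exact ⟨r', hr', α', β', _, hv, rightTerminals_proper D ha⟩

theorem isOperatorGrammar_proper (hG : G.IsOperatorGrammar) : G.proper.IsOperatorGrammar := by
  intro r hr α β B C ho
  obtain ⟨r', hr', he⟩ := exists_erasure_of_mem_proper hr (by simp [ho]; omega)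
  refine erasure_operator_form hG hr' he (α.map G.unliftSymbol) (β.map G.unliftSymbol)
    (B.getD G.initial) (C.getD G.initial) ?_
  rw [ho, List.map_append]
  rfl

theorem opmSubset_proper (hG : G.IsOperatorGrammar) (hM : G.OPMSubset M) :
    G.proper.OPMSubset M :=
  fun a b p h => hM a b p (hasPrec_of_proper hG h)

theorem onlyAxiomEmptyOrRenaming_proper : G.proper.OnlyAxiomEmptyOrRenaming := by
  intro r hr h
  rcases mem_rules_proper.mp hr with ⟨rfl, -⟩ | rfl | ⟨A, w, rfl, -, -, h₀, h₁⟩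
  · rfl
  · rfl
  · rcases h with h | ⟨B, h⟩
    · exact absurd (List.map_eq_nil_iff.mp h) h₀
    · refine absurd ?_ (h₁ (B.getD G.initial))
      have := congrArg (List.map G.unliftSymbol) h
      rw [map_unliftSymbol_map_liftSymbol] at this
      exact this

theorem axiomIsolated_proper : G.proper.AxiomIsolated := by
  intro _ r hr h
  rcases mem_rules_proper.mp hr with ⟨rfl, -⟩ | rfl | ⟨A, w, rfl, -⟩
  · simp at h
  · rw [List.mem_singleton] at h
    cases h
  · obtain ⟨s, -, hs⟩ := List.mem_map.mp h
    cases s <;> cases hs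

/-- Deletion of the nonterminals that derive the empty word. -/
theorem exists_erasure_of_yield {v : List (Symbol T G.NT)} {x : List T}
    (h : Yield (fun B y => G.Gen B y ∧ (y ≠ [] → G.proper.Gen (some B) y)) v x) :
    ∃ w, Erasure v w ∧ G.Derives v w ∧ Yield G.proper.Gen (w.map liftSymbol) x := by
  induction h with
  | nil => exact ⟨[], .nil, Derives.refl _, .nil⟩
  | terminal a _ ih =>
    obtain ⟨w, h₁, h₂, h₃⟩ := ih
    exact ⟨_ :: w, h₁.cons (Symbol.terminal a), h₂.append_left [Symbol.terminal a],
      .terminal a h₃⟩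
  | @nonterminal B v x y hB _ ih =>
    obtain ⟨w, h₁, h₂, h₃⟩ := ih
    by_cases hy : y = []
    · subst hy
      exact ⟨w, h₁.erase B, Derives.append (u := [Symbol.nonterminal B]) hB.1 h₂, h₃⟩
    · exact ⟨_ :: w, h₁.cons (Symbol.nonterminal B), h₂.append_left [Symbol.nonterminal B],
        .nonterminal (R := G.proper.Gen) (some B) (hB.2 hy) h₃⟩

theorem gen_proper {A : G.NT} {x : List T} (h : G.Gen A x) :
    x ≠ [] → G.proper.Gen (some A) x := by
  refine Gen.induction (R := fun A x => x ≠ [] → G.proper.Gen (some A) x) ?_ h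
  intro A v x hr hx hx₀
  obtain ⟨w, h₁, h₂, h₃⟩ := exists_erasure_of_yield hx
  -- If only a renaming `A ⇒* B` is left, the first rule `B → u` used for `B` is replaced by `A →
  -- u`, a rule because `A ⇒* B ⇒* u`.
  by_cases hw : ∃ B, w = [Symbol.nonterminal B]
  · obtain ⟨B, rfl⟩ := hw
    obtain ⟨w', hw', h'⟩ := Gen.exists_rule (Yield.of_singleton h₃)
    rcases mem_rules_proper.mp hw' with ⟨h, -⟩ | h | ⟨C, u, h, he, hd, h₀, h₁⟩
    · cases h
    · cases h
    · cases h
      refine (derives_rule (G := G.proper) (v := u.map liftSymbol) ?_).trans h'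
      exact mem_rules_proper.mpr
        (Or.inr (Or.inr ⟨A, u, rfl, he, ((derives_rule hr).trans h₂).trans hd, h₀, h₁⟩))
  · refine gen_of_rule (G := G.proper) (mem_rules_proper.mpr (Or.inr (Or.inr
      ⟨A, w, rfl, ⟨_, hr, h₁⟩, (derives_rule hr).trans h₂, ?_, fun B h => hw ⟨B, h⟩⟩))) h₃
    rintro rfl
    exact hx₀ h₃.eq_nil

theorem language_proper : G.proper.language = G.language := by
  ext x
  constructor
  · intro h
    have := derives_unliftSymbol (G := G) h
    rw [List.map_map] at this
    exact this
  · intro h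
    by_cases hx : x = []
    · subst hx
      exact derives_rule (G := G.proper) (mem_rules_proper.mpr (Or.inl ⟨rfl, h⟩))
    · exact (derives_rule (G := G.proper) (mem_rules_proper.mpr (Or.inr (Or.inl rfl)))).trans
        (gen_proper h hx)

end Proper

/-- Every operator precedence grammar has an equivalent automaton. -/
theorem IsOPG.exists_opa [Finite T] (hG : G.IsOPG) (hM : G.OPMSubset M) :
    ∃ (Q : Type) (_ : Finite Q) (A : OPA M Q), A.language = G.language := by
  have := hG.finite_nonterminals
  have : Finite G.proper.NT := inferInstanceAs (Finite (Option G.NT))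
  have := G.proper.finite_prefixState
  obtain ⟨Q, hQ, A, hA, -⟩ := (G.proper.prefixAutomaton M).exists_relabel
  exact ⟨Q, hQ, A, hA.trans ((language_prefixAutomaton (isOperatorGrammar_proper hG.operator_form)
    (opmSubset_proper hG.operator_form hM) onlyAxiomEmptyOrRenaming_proper
    axiomIsolated_proper).trans language_proper)⟩

theorem IsOPG.exists_hasOPM (hG : G.IsOPG) : ∃ M : OPM T, G.HasOPM M := by
  classical
  refine ⟨fun a b => if h : ∃ p, G.HasPrec p a b then some h.choose else none, ?_⟩
  intro a b p
  dsimp only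
  split_ifs with h
  · exact ⟨fun hp => Option.some.inj hp ▸ h.choose_spec,
      fun hp => congrArg some (hG.conflict_free a b _ _ h.choose_spec hp)⟩
  · exact iff_of_false id fun hp => h ⟨p, hp⟩

end ContextFreeGrammar

/-! ### The grammar built from an automaton -/

namespace OPA

variable {T Q N : Type*} {M : OPM T}

/-- The nonterminal for the words that lead from the state `q` to the state `q'` between the
terminals `a` and `b`, without touching the stack. -/
def between (e : Option T × Q × Q × Option T ≃ N) (a : Option T) (q q' : Q) (b : Option T) :
    Symbol T (Option N) :=
  Symbol.nonterminal (some (e (a, q, q', b)))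

/-- `Link e a q q' b u`: the string `u` of at most one nonterminal leads from `q` to `q'` between
two consecutive terminals `a` and `b` of a right-hand side. -/
def Link (e : Option T × Q × Q × Option T ≃ N) (a : Option T) (q q' : Q) (b : Option T)
    (u : List (Symbol T (Option N))) : Prop :=
  (u = [] ∧ q = q') ∨ u = [between e a q q' b]

/-- `Handle A e a q₀ p c q w`: the prefix `w` of a right-hand side, which ends with the terminal
`c`, leads from the state `q₀`, with `a` on top of the stack, to the state `q`; then `[c p]` is on
top of the stack. -/
inductive Handle (A : OPA M Q) (e : Option T × Q × Q × Option T ≃ N) (a : Option T)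
    (q₀ p : Q) : T → Q → List (Symbol T (Option N)) → Prop
  | push {r : Q} {d : T} {u : List (Symbol T (Option N))} (hu : Link e a q₀ p (some d) u)
      (h : M.rel a (some d) = some Prec.yields) (hδ : A.push p d r) :
      Handle A e a q₀ p d r (u ++ [Symbol.terminal d])
  | shift {q q₁ r : Q} {c d : T} {w u : List (Symbol T (Option N))}
      (hw : Handle A e a q₀ p c q w) (hu : Link e (some c) q q₁ (some d) u)
      (h : M.rel (some c) (some d) = some Prec.equal) (hδ : A.shift q₁ d r) :
      Handle A e a q₀ p d r (w ++ (u ++ [Symbol.terminal d]))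

/-- The rules of the grammar built from an automaton. -/
def grammarRules (A : OPA M Q) (e : Option T × Q × Q × Option T ≃ N) :
    Set (ContextFreeRule T (Option N)) :=
  {r | (r = ⟨none, []⟩ ∧ ∃ q ∈ A.initial, q ∈ A.final) ∨
    (∃ i ∈ A.initial, ∃ f ∈ A.final, r = ⟨none, [between e none i f none]⟩) ∨
    ∃ a q₀ q' b p c q q₁ w u, r = ⟨some (e (a, q₀, q', b)), w ++ u⟩ ∧ Handle A e a q₀ p c q w ∧
      Link e (some c) q q₁ b u ∧ M.rel (some c) b = some Prec.takes ∧ A.pop q₁ p q'}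

/-- The terminal that a symbol consists of, if any. -/
def _root_.Symbol.terminal? {T N : Type*} : Symbol T N → Option T
  | Symbol.terminal a => some a
  | Symbol.nonterminal _ => none

theorem Link.filterMap_terminal {e : Option T × Q × Q × Option T ≃ N} {a b : Option T} {q q' : Q}
    {u : List (Symbol T (Option N))} (h : Link e a q q' b u) :
    u.filterMap Symbol.terminal? = [] := by
  rcases h with ⟨rfl, -⟩ | rfl <;> rfl

theorem Link.length_le {e : Option T × Q × Q × Option T ≃ N} {a b : Option T} {q q' : Q}
    {u : List (Symbol T (Option N))} (h : Link e a q q' b u) : u.length ≤ 1 := by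
  rcases h with ⟨rfl, -⟩ | rfl <;> simp

variable {A : OPA M Q} {e : Option T × Q × Q × Option T ≃ N}

/-- The terminals of a right-hand side are related by `≐`. -/
theorem Handle.isChain {a : Option T} {q₀ p q : Q} {c : T} {w : List (Symbol T (Option N))}
    (h : Handle A e a q₀ p c q w) :
    ∃ l, w.filterMap Symbol.terminal? = l ++ [c] ∧
      (l ++ [c]).IsChain fun a b => M a b = some Prec.equal := by
  induction h with
  | push hu h hδ =>
    refine ⟨[], ?_, by simp⟩
    rw [List.filterMap_append, hu.filterMap_terminal]
    rfl
  | @shift q q₁ r c d w u hw hu h hδ ih =>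
    obtain ⟨l, hl, hc⟩ := ih
    refine ⟨l ++ [c], ?_, ?_⟩
    · rw [List.filterMap_append, List.filterMap_append, hu.filterMap_terminal, hl]
      rfl
    · rw [List.append_assoc]
      exact List.isChain_append_cons_cons.mpr ⟨hc, h, List.isChain_singleton _⟩

theorem Handle.length_le {a : Option T} {q₀ p q : Q} {c : T} {w : List (Symbol T (Option N))}
    (h : Handle A e a q₀ p c q w) :
    w.length ≤ 2 * (w.filterMap Symbol.terminal?).length := by
  induction h with
  | push hu h hδ =>
    have := hu.length_le
    rw [List.filterMap_append, hu.filterMap_terminal]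
    simp [Symbol.terminal?]
    omega
  | shift hw hu h hδ ih =>
    have := hu.length_le
    rw [List.filterMap_append, List.filterMap_append, hu.filterMap_terminal]
    simp [Symbol.terminal?]
    omega

/-- A repeated terminal would close a cycle of `≐`. -/
theorem _root_.OPM.EqualAcyclic.nodup {M : OPM T} (hM : M.EqualAcyclic) {l : List T}
    (h : l.IsChain fun a b => M a b = some Prec.equal) : l.Nodup := by
  have h' : l.IsChain (Relation.TransGen fun a b => M a b = some Prec.equal) :=
    h.imp fun _ _ h => Relation.TransGen.single h
  refine (List.isChain_iff_pairwise.mp h').imp ?_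
  rintro a _ h rfl
  exact hM a h

theorem finite_grammarRules [Finite T] [Finite N] (A : OPA M Q)
    (e : Option T × Q × Q × Option T ≃ N) (hM : M.EqualAcyclic) : (A.grammarRules e).Finite := by
  have := Fintype.ofFinite T
  have := Fintype.ofFinite N
  have hfin : Finite (Symbol T (Option N)) := inferInstance
  -- A right-hand side has at most `Fintype.card T` terminals, at most one nonterminal before each
  -- of them, and at most one at the end.
  refine Set.Finite.subset ((Set.finite_univ.prod (List.finite_length_le (Symbol T (Option N))
    (2 * Fintype.card T + 1))).image fun z : Option N × List (Symbol T (Option N)) =>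
      (⟨z.1, z.2⟩ : ContextFreeRule T (Option N))) ?_
  rintro r (⟨rfl, -⟩ | ⟨i, -, f, -, rfl⟩ | ⟨a, q₀, q', b, p, c, q, q₁, w, u, rfl, hw, hu, -⟩)
  · exact ⟨(none, []), ⟨trivial, by simp⟩, rfl⟩
  · exact ⟨(none, _), ⟨trivial, by simp⟩, rfl⟩
  · refine ⟨(_, w ++ u), ⟨trivial, ?_⟩, rfl⟩
    obtain ⟨l, hl, hc⟩ := hw.isChain
    have h₁ := (hM.nodup hc).length_le_card
    have h₂ := hw.length_le
    have h₃ := hu.length_le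
    rw [← hl] at h₁
    simp only [Set.mem_ofPred_eq, List.length_append]
    omega

/-- The grammar built from an automaton with finitely many rules. -/
noncomputable abbrev grammar (A : OPA M Q) {N : Type} (e : Option T × Q × Q × Option T ≃ N)
    (h : (A.grammarRules e).Finite) : ContextFreeGrammar T where
  NT := Option N
  initial := none
  rules := h.toFinset

/-! ### Precedence relations of the grammar built from an automaton -/

/-- Consecutive symbols of a right-hand side. -/
def Adjacent (e : Option T × Q × Q × Option T ≃ N) :
    Symbol T (Option N) → Symbol T (Option N) → Prop
  | Symbol.terminal a, Symbol.nonterminal (some n) => (e.symm n).1 = some a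
  | Symbol.nonterminal (some n), Symbol.terminal b => (e.symm n).2.2.2 = some b
  | Symbol.terminal _, Symbol.terminal _ => True
  | _, _ => False

theorem Link.isChain_adjacent {a : T} {q q' : Q} {b : Option T}
    {u w : List (Symbol T (Option N))} (h : Link e (some a) q q' b u)
    (hw : (w ++ [Symbol.terminal a]).IsChain (Adjacent e)) :
    (w ++ [Symbol.terminal a] ++ u).IsChain (Adjacent e) := by
  rcases h with ⟨rfl, -⟩ | rfl
  · simpa using hw
  · rw [List.append_assoc]
    exact List.isChain_append_cons_cons.mpr ⟨hw, by simp [Adjacent, between],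
      List.isChain_singleton _⟩

theorem Handle.isChain_adjacent {a : Option T} {q₀ p q : Q} {c : T}
    {w : List (Symbol T (Option N))} (h : Handle A e a q₀ p c q w) :
    ∃ l, w = l ++ [Symbol.terminal c] ∧ w.IsChain (Adjacent e) := by
  induction h with
  | @push r d u hu h hδ =>
    refine ⟨u, rfl, ?_⟩
    rcases hu with ⟨rfl, -⟩ | rfl
    · simp
    · simp [Adjacent, between]
  | @shift q q₁ r c d w u hw hu h hδ ih =>
    obtain ⟨l, rfl, hc⟩ := ih
    refine ⟨l ++ [Symbol.terminal c] ++ u, by simp, ?_⟩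
    rcases hu with ⟨rfl, -⟩ | rfl
    · rw [List.nil_append, List.append_assoc]
      exact List.isChain_append_cons_cons.mpr ⟨hc, by simp [Adjacent], List.isChain_singleton _⟩
    · rw [List.append_assoc]
      exact List.isChain_append_cons_cons.mpr ⟨hc, by simp [Adjacent, between],
        by simp [Adjacent, between]⟩

/-- `Starts P R l`: the list `l` starts with a terminal that satisfies `R`, possibly preceded by a
nonterminal that satisfies `P`. -/
def Starts (P : N → Prop) (R : T → Prop) (l : List (Symbol T (Option N))) : Prop :=
  ∃ d m, R d ∧ (l = Symbol.terminal d :: m ∨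
    ∃ n, P n ∧ l = Symbol.nonterminal (some n) :: Symbol.terminal d :: m)

theorem Starts.append {P : N → Prop} {R : T → Prop} {l : List (Symbol T (Option N))}
    (h : Starts P R l) (m : List (Symbol T (Option N))) : Starts P R (l ++ m) := by
  obtain ⟨d, k, hd, rfl | ⟨n, hn, rfl⟩⟩ := h
  · exact ⟨d, k ++ m, hd, Or.inl rfl⟩
  · exact ⟨d, k ++ m, hd, Or.inr ⟨n, hn, rfl⟩⟩

/-- A rewriting either replaces the leading nonterminal, where `hv` applies, or happens after the
first terminal. -/
theorem Starts.replace {P : N → Prop} {R : T → Prop} {p v q : List (Symbol T (Option N))}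
    {B : Option N} (h : Starts P R (p ++ [Symbol.nonterminal B] ++ q))
    (hv : ∀ n, B = some n → P n → Starts P R v) : Starts P R (p ++ v ++ q) := by
  obtain ⟨d, m, hd, h | ⟨n, hn, h⟩⟩ := h
  · rcases p with _ | ⟨s, p⟩
    · simp at h
    · simp only [List.cons_append, List.cons.injEq] at h
      exact ⟨d, p ++ v ++ q, hd, Or.inl (by simp [h.1])⟩
  · rcases p with _ | ⟨s, _ | ⟨s', p⟩⟩
    · simp only [List.nil_append, List.singleton_append, List.cons.injEq,
        Symbol.nonterminal.injEq] at h
      exact (hv n h.1 hn).append q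
    · simp at h
    · simp only [List.cons_append, List.cons.injEq] at h
      exact ⟨d, p ++ v ++ q, hd, Or.inr ⟨n, hn, by simp [h.1, h.2.1]⟩⟩

theorem Starts.of_cons {P : N → Prop} {R : T → Prop} {d : T} {m : List (Symbol T (Option N))}
    (h : Starts P R (Symbol.terminal d :: m)) : R d := by
  obtain ⟨d', m', hd, h | ⟨n, hn, h⟩⟩ := h
  · cases h
    exact hd
  · cases h

theorem Starts.of_cons_cons {P : N → Prop} {R : T → Prop} {d : T} {B : Option N}
    {m : List (Symbol T (Option N))}
    (h : Starts P R (Symbol.nonterminal B :: Symbol.terminal d :: m)) : R d := by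
  obtain ⟨d', m', hd, h | ⟨n, hn, h⟩⟩ := h
  · cases h
  · cases h
    exact hd

theorem Handle.starts {a : Option T} {q₀ p q : Q} {c : T} {w : List (Symbol T (Option N))}
    (h : Handle A e a q₀ p c q w) :
    Starts (fun n => (e.symm n).1 = a) (fun d => M.rel a (some d) = some Prec.yields) w := by
  induction h with
  | @push r d u hu h hδ =>
    refine ⟨d, [], h, ?_⟩
    rcases hu with ⟨rfl, -⟩ | rfl
    · exact Or.inl rfl
    · exact Or.inr ⟨_, by simp, rfl⟩
  | shift hw hu h hδ ih => exact ih.append _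

/-- Right ends are treated as left ends of the reversed string, so that `Starts` serves both sides.
-/
theorem Handle.starts_reverse {a b : Option T} {q₀ p q q₁ : Q} {c : T}
    {w u : List (Symbol T (Option N))} (h : Handle A e a q₀ p c q w)
    (hu : Link e (some c) q q₁ b u) (hb : M.rel (some c) b = some Prec.takes) :
    Starts (fun n => (e.symm n).2.2.2 = b) (fun d => M.rel (some d) b = some Prec.takes)
      (w ++ u).reverse := by
  obtain ⟨l, rfl, -⟩ := h.isChain_adjacent
  refine ⟨c, l.reverse, hb, ?_⟩
  rcases hu with ⟨rfl, -⟩ | rfl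
  · exact Or.inl (by simp)
  · exact Or.inr ⟨e (some c, q, q₁, b), by simp, by simp [between]⟩

section Grammar

variable {N : Type} {e : Option T × Q × Q × Option T ≃ N} {hfin : (A.grammarRules e).Finite}

theorem mem_rules_grammar {r : ContextFreeRule T (Option N)} :
    r ∈ (A.grammar e hfin).rules ↔ r ∈ A.grammarRules e :=
  Set.Finite.mem_toFinset _

theorem exists_handle_of_mem {n : N} {v : List (Symbol T (Option N))}
    (h : ⟨some n, v⟩ ∈ (A.grammar e hfin).rules) :
    ∃ a q₀ q' b p c q q₁ w u, e.symm n = (a, q₀, q', b) ∧ v = w ++ u ∧ Handle A e a q₀ p c q w ∧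
      Link e (some c) q q₁ b u ∧ M.rel (some c) b = some Prec.takes ∧ A.pop q₁ p q' := by
  rcases mem_rules_grammar.mp h with ⟨h, -⟩ | ⟨i, -, f, -, h⟩ |
    ⟨a, q₀, q', b, p, c, q, q₁, w, u, h, h'⟩
  · cases h
  · cases h
  · cases h
    exact ⟨a, q₀, q', b, p, c, q, q₁, w, u, by simp, rfl, h'⟩

/-- A leading nonterminal of a right-hand side inherits the left context of the left-hand side. So
every string derived from `n`, other than `n` itself, starts under the same context, to which its
first terminal is related by `⋖`. -/
theorem leftTerminals_grammar (n : N) {d : T}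
    (hd : d ∈ (A.grammar e hfin).leftTerminals (some n)) :
    M.rel (e.symm n).1 (some d) = some Prec.yields := by
  obtain ⟨B, α, h⟩ := hd
  have hrule : ∀ n' v, ⟨some n', v⟩ ∈ (A.grammar e hfin).rules → (e.symm n').1 = (e.symm n).1 →
      Starts (fun m => (e.symm m).1 = (e.symm n).1)
        (fun d => M.rel (e.symm n).1 (some d) = some Prec.yields) v := by
    intro n' v hv hn
    obtain ⟨a, q₀, q', b, p, c, q, q₁, w, u, hn', rfl, hw, -⟩ := exists_handle_of_mem hv
    rw [← hn, hn']
    exact hw.starts.append u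
  have key : ∀ l, (A.grammar e hfin).Derives [Symbol.nonterminal (some n)] l →
      l = [Symbol.nonterminal (some n)] ∨ Starts (fun m => (e.symm m).1 = (e.symm n).1)
        (fun d => M.rel (e.symm n).1 (some d) = some Prec.yields) l := by
    intro l hl
    induction hl with
    | refl => exact Or.inl rfl
    | tail _ h ih =>
      obtain ⟨⟨B, v⟩, hr, h⟩ := h
      obtain ⟨p, q, rfl, rfl⟩ := h.exists_parts
      rcases ih with ih | ih
      · obtain ⟨rfl, rfl, rfl⟩ : p = [] ∧ q = [] ∧ B = some n := by
          rcases p with _ | ⟨s, p⟩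
          · simpa [and_comm] using ih
          · simp at ih
        simpa using Or.inr (hrule n v hr rfl)
      · refine Or.inr (ih.replace ?_)
        rintro m rfl hm
        exact hrule m v hr hm
  rcases B with _ | B
  · rcases key _ h with h | h
    · simp [ContextFreeGrammar.optNT] at h
    · exact h.of_cons
  · rcases key _ h with h | h
    · simp [ContextFreeGrammar.optNT] at h
    · exact h.of_cons_cons

theorem rightTerminals_grammar (n : N) {d : T}
    (hd : d ∈ (A.grammar e hfin).rightTerminals (some n)) :
    M.rel (some d) (e.symm n).2.2.2 = some Prec.takes := by
  obtain ⟨B, α, h⟩ := hd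
  have hrule : ∀ n' v, ⟨some n', v⟩ ∈ (A.grammar e hfin).rules →
      (e.symm n').2.2.2 = (e.symm n).2.2.2 →
      Starts (fun m => (e.symm m).2.2.2 = (e.symm n).2.2.2)
        (fun d => M.rel (some d) (e.symm n).2.2.2 = some Prec.takes) v.reverse := by
    intro n' v hv hn
    obtain ⟨a, q₀, q', b, p, c, q, q₁, w, u, hn', rfl, hw, hu, hb, -⟩ := exists_handle_of_mem hv
    rw [← hn, hn']
    exact hw.starts_reverse hu hb
  have key : ∀ l, (A.grammar e hfin).Derives [Symbol.nonterminal (some n)] l →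
      l = [Symbol.nonterminal (some n)] ∨
      Starts (fun m => (e.symm m).2.2.2 = (e.symm n).2.2.2)
        (fun d => M.rel (some d) (e.symm n).2.2.2 = some Prec.takes) l.reverse := by
    intro l hl
    induction hl with
    | refl => exact Or.inl rfl
    | tail _ h ih =>
      obtain ⟨⟨B, v⟩, hr, h⟩ := h
      obtain ⟨p, q, rfl, rfl⟩ := h.exists_parts
      rcases ih with ih | ih
      · obtain ⟨rfl, rfl, rfl⟩ : p = [] ∧ q = [] ∧ B = some n := by
          rcases p with _ | ⟨s, p⟩
          · simpa [and_comm] using ih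
          · simp at ih
        simpa using Or.inr (hrule n v hr rfl)
      · have ih' : Starts (fun m => (e.symm m).2.2.2 = (e.symm n).2.2.2)
            (fun d => M.rel (some d) (e.symm n).2.2.2 = some Prec.takes)
            (q.reverse ++ [Symbol.nonterminal B] ++ p.reverse) := by simpa using ih
        have := ih'.replace (v := v.reverse) (by rintro m rfl hm; exact hrule m v hr hm)
        exact Or.inr (by simpa using this)
  rcases B with _ | B
  · rcases key _ h with h | h
    · rcases α with _ | ⟨s, α⟩ <;> simp [ContextFreeGrammar.optNT] at h
    · rw [ContextFreeGrammar.optNT, List.reverse_append, List.reverse_cons] at h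
      exact Starts.of_cons (R := fun d => M.rel (some d) (e.symm n).2.2.2 = some Prec.takes)
        (m := α.reverse) h
  · rcases key _ h with h | h
    · rcases α with _ | ⟨s, α⟩ <;> simp [ContextFreeGrammar.optNT] at h
    · rw [ContextFreeGrammar.optNT, List.reverse_append, List.reverse_cons] at h
      exact Starts.of_cons_cons
        (R := fun d => M.rel (some d) (e.symm n).2.2.2 = some Prec.takes) (m := α.reverse)
        (B := B) h

/-- Consecutive symbols of a right-hand side are `Adjacent`, and consecutive terminals are related
by `≐`. -/
theorem isChain_of_mem_rules {r : ContextFreeRule T (Option N)}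
    (hr : r ∈ (A.grammar e hfin).rules) :
    r.output.IsChain (Adjacent e) ∧
      (r.output.filterMap Symbol.terminal?).IsChain fun a b => M a b = some Prec.equal := by
  rcases mem_rules_grammar.mp hr with ⟨rfl, -⟩ | ⟨i, -, f, -, rfl⟩ |
    ⟨a, q₀, q', b, p, c, q, q₁, w, u, rfl, hw, hu, -⟩
  · simp
  · exact ⟨List.isChain_singleton _, List.isChain_nil⟩
  · constructor
    · obtain ⟨l, rfl, h⟩ := hw.isChain_adjacent
      exact hu.isChain_adjacent h
    · obtain ⟨l, hl, h⟩ := hw.isChain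
      rw [List.filterMap_append, hu.filterMap_terminal, List.append_nil, hl]
      exact h

theorem adjacent_of_mem_rules {r : ContextFreeRule T (Option N)}
    (hr : r ∈ (A.grammar e hfin).rules) {α β : List (Symbol T (Option N))}
    {s s' : Symbol T (Option N)} (h : r.output = α ++ s :: s' :: β) : Adjacent e s s' := by
  have := (isChain_of_mem_rules hr).1
  rw [h] at this
  exact (List.isChain_append_cons_cons.mp this).2.1

/-- The contexts stored in a nonterminal are its actual neighbours in a right-hand side, by
`Adjacent`; the relations `⋖` and `⋗` then follow from the terminal sets, and `≐` from the chain of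
terminals. -/
theorem opmSubset_grammar : (A.grammar e hfin).OPMSubset M := by
  intro a b p h
  cases p with
  | yields =>
    obtain ⟨r, hr, α, β, D, ho, hb⟩ := h
    have hadj := adjacent_of_mem_rules hr ho
    rcases D with _ | n
    · exact hadj.elim
    · have := leftTerminals_grammar n hb
      rwa [show (e.symm n).1 = some a from hadj] at this
  | equal =>
    obtain ⟨r, hr, α, β, B, ho⟩ := h
    have hc := (isChain_of_mem_rules hr).2
    have hB : ((A.grammar e hfin).optNT B).filterMap Symbol.terminal? = [] := by
      cases B <;> rfl
    rw [ho, List.filterMap_append, List.filterMap_cons, List.filterMap_append, hB] at hc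
    exact (List.isChain_append_cons_cons.mp hc).2.1
  | takes =>
    obtain ⟨r, hr, α, β, D, ho, ha⟩ := h
    have hadj := adjacent_of_mem_rules hr ho
    rcases D with _ | n
    · exact hadj.elim
    · have := rightTerminals_grammar n ha
      rwa [show (e.symm n).2.2.2 = some b from hadj] at this

theorem isOPG_grammar [Finite N] : (A.grammar e hfin).IsOPG where
  finite_nonterminals := inferInstanceAs (Finite (Option N))
  operator_form r hr α β B C h := by
    have hadj := adjacent_of_mem_rules hr h
    rcases B with _ | B <;> exact hadj.elim
  conflict_free a b r r' h h' :=
    Option.some.inj ((opmSubset_grammar a b r h).symm.trans (opmSubset_grammar a b r' h'))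

/-! ### The language of the grammar built from an automaton -/

/-- The runs of the automaton that correspond to the nonterminals. -/
def Runs (A : OPA M Q) (e : Option T × Q × Q × Option T ≃ N) : Option N → List T → Prop
  | none, x => x ∈ A.language
  | some n, x => ∀ (s : List (T × Q)) (y : List T), topSymbol s = (e.symm n).1 →
      y.head? = (e.symm n).2.2.2 →
      Relation.ReflTransGen A.Move ⟨x ++ y, (e.symm n).2.1, s⟩ ⟨y, (e.symm n).2.2.1, s⟩

theorem Link.run {a b : Option T} {q q' : Q} {u : List (Symbol T (Option N))} {x : List T}
    (h : Link e a q q' b u) (hx : Yield (Runs A e) u x) {s : List (T × Q)} {y : List T}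
    (hs : topSymbol s = a) (hy : y.head? = b) :
    Relation.ReflTransGen A.Move ⟨x ++ y, q, s⟩ ⟨y, q', s⟩ := by
  rcases h with ⟨rfl, rfl⟩ | rfl
  · cases hx
    exact .refl
  · have := hx.of_singleton s y
    simp only [Equiv.symm_apply_apply] at this
    exact this hs hy

/-- Each nonterminal of the handle contributes a run that restores the stack, and each terminal the
push or shift recorded in the handle. -/
theorem Handle.run {a : Option T} {q₀ p q : Q} {c : T} {w : List (Symbol T (Option N))}
    (h : Handle A e a q₀ p c q w) {x : List T} (hx : Yield (Runs A e) w x) {s : List (T × Q)}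
    (y : List T) (hs : topSymbol s = a) :
    Relation.ReflTransGen A.Move ⟨x ++ y, q₀, s⟩ ⟨y, q, (c, p) :: s⟩ := by
  induction h generalizing x y with
  | @push r d u hu h hδ =>
    obtain ⟨x₁, x₂, rfl, h₁, h₂⟩ := hx.exists_of_append
    obtain rfl := h₂.of_singleton_terminal
    rw [List.append_assoc]
    exact (hu.run h₁ (y := [d] ++ y) hs rfl).tail (.push d y p r s (hs ▸ h) hδ)
  | @shift q q₁ r c d w u hw hu h hδ ih =>
    obtain ⟨x₁, x₂, rfl, h₁, h₂⟩ := hx.exists_of_append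
    obtain ⟨x₂, x₃, rfl, h₃, h₄⟩ := h₂.exists_of_append
    obtain rfl := h₄.of_singleton_terminal
    rw [List.append_assoc, List.append_assoc]
    exact ((ih h₁ _).trans (hu.run h₃ (y := [d] ++ y) rfl rfl)).tail
      (.shift c d y p q₁ r s h hδ)

theorem runs_of_rule {B : Option N} {v : List (Symbol T (Option N))} {x : List T}
    (hr : ⟨B, v⟩ ∈ (A.grammar e hfin).rules) (hx : Yield (Runs A e) v x) : Runs A e B x := by
  rcases mem_rules_grammar.mp hr with ⟨h, q, hi, hf⟩ | ⟨i, hi, f, hf, h⟩ |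
    ⟨a, q₀, q', b, p, c, q, q₁, w, u, h, hw, hu, hb, hδ⟩
  · cases h
    cases hx
    exact ⟨q, hi, q, hf, .refl⟩
  · cases h
    have := Link.run (Or.inr rfl) hx (s := []) (y := []) rfl rfl
    rw [List.append_nil] at this
    exact ⟨i, hi, f, hf, this⟩
  · cases h
    intro s y
    simp only [Equiv.symm_apply_apply]
    intro hs hy
    obtain ⟨x₁, x₂, rfl, h₁, h₂⟩ := hx.exists_of_append
    rw [List.append_assoc]
    exact ((hw.run h₁ _ hs).trans (hu.run h₂ rfl hy)).tail (.pop c y p q₁ q' s (hy ▸ hb) hδ)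

/-- `Stacked A e hfin s q x`: reading the word `x` the automaton may reach the state `q` with stack
`s`, having just read the topmost symbol of `s`; each symbol of `s` ends a prefix of a right-hand
side. -/
inductive Stacked (A : OPA M Q) (e : Option T × Q × Q × Option T ≃ N)
    (hfin : (A.grammarRules e).Finite) : List (T × Q) → Q → List T → Prop
  | nil {i : Q} (hi : i ∈ A.initial) : Stacked A e hfin [] i []
  | cons {s : List (T × Q)} {q₀ p q : Q} {c : T} {w : List (Symbol T (Option N))} {x y : List T}
      (hs : Stacked A e hfin s q₀ x) (hw : Handle A e (topSymbol s) q₀ p c q w)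
      (hy : Yield (A.grammar e hfin).Gen w y) : Stacked A e hfin ((c, p) :: s) q (x ++ y)

/-- The string `u` describes what happened since the topmost symbol was last read. A push or shift
absorbs it into a handle; a pop completes the top handle with it to a rule, whose left-hand side is
the new `u'`. -/
theorem stacked_move {c d : OPAConfig T Q} (h : A.Move c d) {x z : List T} {q₀ : Q}
    {u : List (Symbol T (Option N))} (hs : Stacked A e hfin c.stack q₀ x)
    (hu : Link e (topSymbol c.stack) q₀ c.state c.input.head? u)
    (hz : Yield (A.grammar e hfin).Gen u z) :
    ∃ x' z' q₀' u', x ++ z ++ c.input = x' ++ z' ++ d.input ∧ Stacked A e hfin d.stack q₀' x' ∧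
      Link e (topSymbol d.stack) q₀' d.state d.input.head? u' ∧
      Yield (A.grammar e hfin).Gen u' z' := by
  cases h with
  | push a y p q s h hδ =>
    exact ⟨x ++ (z ++ [a]), [], q, [], by simp,
      .cons hs (.push hu h hδ) (hz.append (.singleton_terminal a)), Or.inl ⟨rfl, rfl⟩, .nil⟩
  | shift a b y p q r s h hδ =>
    cases hs with
    | @cons _ _ _ _ _ _ x₁ x₂ hs hw hy =>
      exact ⟨x₁ ++ (x₂ ++ (z ++ [b])), [], r, [], by simp,
        .cons hs (.shift hw hu h hδ) (hy.append (hz.append (.singleton_terminal b))),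
        Or.inl ⟨rfl, rfl⟩, .nil⟩
  | pop a y p q r s h hδ =>
    cases hs with
    | @cons _ q₁ _ _ _ w x₁ x₂ hs hw hy =>
      refine ⟨x₁, x₂ ++ z, q₁, _, by simp, hs, Or.inr rfl, .singleton ?_⟩
      exact ContextFreeGrammar.gen_of_rule (mem_rules_grammar.mpr (Or.inr (Or.inr
        ⟨_, _, _, _, _, _, _, _, _, _, rfl, hw, hu, h, hδ⟩))) (hy.append hz)

theorem language_grammar : (A.grammar e hfin).language = A.language := by
  ext x
  constructor
  · intro h
    exact (ContextFreeGrammar.yield_of_derives (R := Runs A e) (fun _ _ _ => runs_of_rule)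
      h).of_singleton
  · rintro ⟨i, hi, f, hf, hrun⟩
    have key : ∀ d, Relation.ReflTransGen A.Move ⟨x, i, []⟩ d →
        ∃ x' z' q₀' u', x = x' ++ z' ++ d.input ∧ Stacked A e hfin d.stack q₀' x' ∧
          Link e (topSymbol d.stack) q₀' d.state d.input.head? u' ∧
          Yield (A.grammar e hfin).Gen u' z' := by
      intro d hd
      induction hd with
      | refl => exact ⟨[], [], i, [], rfl, .nil hi, Or.inl ⟨rfl, rfl⟩, .nil⟩
      | tail _ h ih =>
        obtain ⟨x', z', q₀, u, hx, hs, hu, hz⟩ := ih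
        rw [hx]
        exact stacked_move h hs hu hz
    obtain ⟨x', z, q₀, u, rfl, hs, hu, hz⟩ := key _ hrun
    cases hs with
    | nil hi =>
      rw [List.nil_append, List.append_nil]
      rcases hu with ⟨rfl, rfl⟩ | rfl
      · cases hz
        exact ContextFreeGrammar.derives_rule (G := A.grammar e hfin)
          (mem_rules_grammar.mpr (Or.inl ⟨rfl, _, hi, hf⟩))
      · exact ContextFreeGrammar.gen_of_rule (G := A.grammar e hfin)
          (mem_rules_grammar.mpr (Or.inr (Or.inl ⟨_, hi, f, hf, rfl⟩))) hz

end Grammar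

/-- Over a matrix whose relation `≐` has no circularities, every automaton has an equivalent
operator precedence grammar. -/
theorem exists_grammar [Finite T] [Finite Q] (hM : M.EqualAcyclic) (A : OPA M Q) :
    ∃ G : ContextFreeGrammar T, G.IsOPG ∧ G.OPMSubset M ∧ G.language = A.language :=
  have e := Finite.equivFin (Option T × Q × Q × Option T)
  ⟨A.grammar e (A.finite_grammarRules e hM), isOPG_grammar, opmSubset_grammar, language_grammar⟩

end OPA

theorem mainTheorem5 :
    -- every operator precedence grammar has an equivalent automaton over its own matrix, and over
    -- every conflict-free matrix that contains it
    (∀ (T : Type*) [Finite T] (G : ContextFreeGrammar T), G.IsOPG →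
      (∃ M : OPM T, G.HasOPM M) ∧
      ∀ M : OPM T, G.OPMSubset M →
        ∃ (Q : Type) (_ : Finite Q) (A : OPA M Q), A.language = G.language) ∧
    -- over a matrix whose relation `≐` has no circularities, the two formalisms define the same
    -- languages
    (∀ (T : Type*) [Finite T] (M : OPM T), M.EqualAcyclic → ∀ L : Language T,
      (∃ (Q : Type) (_ : Finite Q) (A : OPA M Q), A.language = L) ↔
        ∃ G : ContextFreeGrammar T, G.IsOPG ∧ G.OPMSubset M ∧ G.language = L) ∧
    -- determinization with `2 ^ O(s²)` states
    (∃ C : ℕ, ∀ (T : Type*) [Finite T] (M : OPM T) (Q : Type*) [Finite Q] (A : OPA M Q),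
      ∃ (Q' : Type) (_ : Finite Q') (D : OPA M Q'), D.IsDeterministic ∧
        D.language = A.language ∧ Nat.card Q' ≤ 2 ^ (C * Nat.card Q ^ 2)) ∧
    -- the automaton built from a grammar is equivalent to it, and is already deterministic for a
    -- grammar in Fischer normal form
    (∀ (T : Type*) [Finite T] (G : ContextFreeGrammar T) (M : OPM T),
      G.IsOPG → G.OPMSubset M → G.OnlyAxiomEmptyOrRenaming → G.AxiomIsolated →
        Finite G.PrefixState ∧
        (G.prefixAutomaton M).language = G.language ∧
        (G.IsFNF → (G.prefixAutomaton M).completion.IsDeterministic ∧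
          (G.prefixAutomaton M).completion.language = G.language)) ∧
    -- every grammar in Fischer normal form has an equivalent deterministic automaton
    (∀ (T : Type*) [Finite T] (G : ContextFreeGrammar T) (M : OPM T),
      G.IsOPG → G.OPMSubset M → G.IsFNF →
        ∃ (Q : Type) (_ : Finite Q) (D : OPA M Q), D.IsDeterministic ∧
          D.language = G.language) := by
  refine ⟨?_, ?_, ?_, ?_, ?_⟩
  · intro T _ G hG
    exact ⟨hG.exists_hasOPM, fun M hM => hG.exists_opa hM⟩
  · intro T _ M hM L
    constructor
    · rintro ⟨Q, _, A, rfl⟩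
      exact A.exists_grammar hM
    · rintro ⟨G, hG, hGM, rfl⟩
      exact hG.exists_opa hGM
  · refine ⟨1, fun T _ M Q _ A => ?_⟩
    obtain ⟨Q', hQ', D, hD, hL, hcard⟩ := A.exists_isDeterministic
    exact ⟨Q', hQ', D, hD, hL, by rw [hcard, one_mul]⟩
  · intro T _ G M hG hM h₁ h₂
    have := hG.finite_nonterminals
    have hL := ContextFreeGrammar.language_prefixAutomaton hG.operator_form hM h₁ h₂
    exact ⟨G.finite_prefixState, hL, fun hF =>
      ⟨ContextFreeGrammar.isDeterministic_completion_prefixAutomaton M hF.invertible,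
        (OPA.language_completion _).trans hL⟩⟩
  · intro T _ G M hG hM _
    -- Fischer normal form does not isolate the axiom, so the route is through the proper grammar
    -- and the subset construction.
    obtain ⟨Q, _, A, hA⟩ := hG.exists_opa hM
    obtain ⟨Q', hQ', D, hD, hL, -⟩ := A.exists_isDeterministic
    exact ⟨Q', hQ', D, hD, hL.trans hA⟩
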